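/- Let $\Sigma=\{X,N,S,R\}$ and let $\phi:\Sigma^*\to\mathrm{GL}(2,\mathbb{Z})$ be the monoid morphism with $$\phi(X)=\begin{bmatrix}-1&0\\0&-1\end{bmatrix},\quad \phi(N)=\begin{bmatrix}1&0\\0&-1\end{bmatrix},\quad \phi(S)=\begin{bmatrix}0&-1\\1&0\end{bmatrix},\quad \phi(R)=\begin{bmatrix}0&-1\\1&1\end{bmatrix}.$$ A subset $\mathcal{S}\subseteq\mathrm{GL}(2,\mathbb{Z})$ is called regular if $\mathcal{S}=\phi(L)$ for some regular language $L\subseteq\Sigma^*$; it is presented by any finite automaton $\mathcal{A}$ over $\Sigma$ (nondeterministic, $\varepsilon$-transitions allowed) with $\mathcal{S}=\phi(L(\mathcal{A}))$. **Theorem.** There is an algorithm which, given $t\ge 1$, nonsingular matrices $M_1,\dots,M_t\in\mathbb{Z}^{2\times 2}$ and regular subsets $\mathcal{S}_1,\dots,\mathcal{S}_t$ of $\mathrm{GL}(2,\mathbb{Z})$, each presented by a finite automaton, decides whether there exist matrices $A_1\in\mathcal{S}_1,\dots,A_t\in\mathcal{S}_t$ such that $$A_1M_1A_2M_2\cdots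 A_{t-1}M_{t-1}A_t=M_t.$$ (For $t=1$ the equation reads $A_1=M_1$.) -/

import Mathlib

namespace GL2Z

/-- The alphabet `Σ = {X, N, S, R}`. -/
inductive Letter
  | X
  | N
  | S
  | R

namespace Letter

def toFin : Letter → Fin 4
  | X => 0
  | N => 1
  | S => 2
  | R => 3

def ofFin : Fin 4 → Letter
  | 0 => X
  | 1 => N
  | 2 => S
  | 3 => R

def equivFin : Letter ≃ Fin 4 where
  toFun := toFin
  invFun := ofFin
  left_inv := by intro a; cases a <;> rfl
  right_inv := by intro i; fin_cases i <;> rfl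

instance : Primcodable Letter := Primcodable.ofEquiv (Fin 4) equivFin

instance : Fintype Letter := Fintype.ofEquiv (Fin 4) equivFin.symm

/-- The matrix of a letter; each unit is given as a matrix together with its inverse. -/
def toGL : Letter → Matrix.GeneralLinearGroup (Fin 2) ℤ
  | X => ⟨!![-1, 0; 0, -1], !![-1, 0; 0, -1], by decide, by decide⟩
  | N => ⟨!![1, 0; 0, -1], !![1, 0; 0, -1], by decide, by decide⟩
  | S => ⟨!![0, -1; 1, 0], !![0, 1; -1, 0], by decide, by decide⟩
  | R => ⟨!![0, -1; 1, 1], !![1, 1; -1, 0], by decide, by decide⟩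

end Letter

/-- The morphism `φ : Σ* → GL(2, ℤ)`. -/
def phi (w : List Letter) : Matrix.GeneralLinearGroup (Fin 2) ℤ :=
  (w.map Letter.toGL).prod

/-- A subset of `GL(2, ℤ)` is regular if it is the image under `φ` of a regular language. -/
def IsRegularSubset (S : Set (Matrix.GeneralLinearGroup (Fin 2) ℤ)) : Prop :=
  ∃ L : Language Letter, L.IsRegular ∧ S = phi '' {w | w ∈ L}

/-- A finite automaton with ε-transitions over `Σ`, written down as finite data: the number of
states, the list of transitions `(source, label, target)`, where the label `none` stands for `ε`,
and the lists of initial and accepting states. The states are the numbers `< numStates`;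
entries that mention other numbers have no effect. -/
structure Automaton where
  numStates : ℕ
  transitions : List (ℕ × Option Letter × ℕ)
  initial : List ℕ
  accepting : List ℕ

namespace Automaton

def equivProd :
    Automaton ≃ ℕ × List (ℕ × Option Letter × ℕ) × List ℕ × List ℕ where
  toFun a := (a.numStates, a.transitions, a.initial, a.accepting)
  invFun p := ⟨p.1, p.2.1, p.2.2.1, p.2.2.2⟩
  left_inv _ := rfl
  right_inv _ := rfl

instance : Primcodable Automaton := Primcodable.ofEquiv _ equivProd

def toεNFA (a : Automaton) : εNFA Letter (Fin a.numStates) where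
  step s x := {s' | ((s : ℕ), x, (s' : ℕ)) ∈ a.transitions}
  start := {s | (s : ℕ) ∈ a.initial}
  accept := {s | (s : ℕ) ∈ a.accepting}

/-- The language recognized by the automaton. -/
def language (a : Automaton) : Language Letter := a.toεNFA.accepts

/-- The regular subset `φ(L(a))` of `GL(2, ℤ)` given by the automaton `a`. -/
def subset (a : Automaton) : Set (Matrix.GeneralLinearGroup (Fin 2) ℤ) :=
  phi '' {w | w ∈ a.language}

theorem isRegular_language (a : Automaton) : a.language.IsRegular := by
  classical
  refine ⟨Set (Fin a.numStates), inferInstance, a.toεNFA.toNFA.toDFA, ?_⟩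
  rw [NFA.toDFA_correct, εNFA.toNFA_correct]
  rfl

theorem exists_language_eq {L : Language Letter} (hL : L.IsRegular) :
    ∃ a : Automaton, a.language = L := by
  classical
  obtain ⟨σ, _, M, rfl⟩ := hL
  let e := Fintype.equivFin σ
  let a : Automaton :=
    { numStates := Fintype.card σ
      transitions := (Finset.univ : Finset (σ × Letter)).toList.map
        fun p => ((e p.1 : ℕ), some p.2, (e (M.step p.1 p.2) : ℕ))
      initial := [(e M.start : ℕ)]
      accepting := (Finset.univ.filter (· ∈ M.accept)).toList.map fun s => (e s : ℕ) }
  refine ⟨a, ?_⟩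
  have key : a.toεNFA = (M.reindex e).toNFA.toεNFA := by
    have h1 : ∀ (s : Fin (Fintype.card σ)) (x : Option Letter), a.toεNFA.step s x =
        (M.reindex e).toNFA.toεNFA.step s x := by
      intro s x
      ext s'
      cases x with
      | none => simp [a, toεNFA, NFA.toεNFA]
      | some x =>
        simp only [a, toεNFA, NFA.toεNFA, DFA.toNFA, Set.mem_ofPred_eq, List.mem_map,
          Finset.mem_toList, Finset.mem_univ, true_and, Prod.mk.injEq, Option.some.injEq,
          Prod.exists, DFA.reindex_apply_step]
        constructor
        · rintro ⟨q, y, h, rfl, h'⟩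
          have hq : s = e q := Fin.ext h.symm
          subst hq
          rw [Equiv.symm_apply_apply]
          exact Fin.ext h'.symm
        · rintro rfl
          exact ⟨e.symm s, x, by simp, rfl, rfl⟩
    have h2 : a.toεNFA.start = (M.reindex e).toNFA.toεNFA.start := by
      ext s
      simp [a, toεNFA, NFA.toεNFA, DFA.toNFA, Fin.ext_iff]
    have h3 : a.toεNFA.accept = (M.reindex e).toNFA.toεNFA.accept := by
      ext s
      simp only [a, toεNFA, NFA.toεNFA, DFA.toNFA, Set.mem_ofPred_eq, List.mem_map,
        Finset.mem_toList, Finset.mem_filter, Finset.mem_univ, true_and,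
        DFA.reindex_apply_accept, Set.mem_preimage]
      constructor
      · rintro ⟨q, hq, h⟩
        have hs : s = e q := Fin.ext h.symm
        subst hs
        simpa using hq
      · intro h
        exact ⟨e.symm s, h, by simp⟩
    exact (εNFA.mk.injEq _ _ _ _ _ _).mpr ⟨funext fun s => funext (h1 s), h2, h3⟩
  change a.toεNFA.accepts = _
  rw [key, NFA.toεNFA_correct, DFA.toNFA_correct, DFA.accepts_reindex]

/-- The regular subsets of `GL(2, ℤ)` are exactly the subsets given by automata. -/
theorem isRegularSubset_iff (S : Set (Matrix.GeneralLinearGroup (Fin 2) ℤ)) :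
    IsRegularSubset S ↔ ∃ a : Automaton, S = a.subset := by
  constructor
  · rintro ⟨L, hL, rfl⟩
    obtain ⟨a, rfl⟩ := exists_language_eq hL
    exact ⟨a, rfl⟩
  · rintro ⟨a, rfl⟩
    exact ⟨a.language, a.isRegular_language, rfl⟩

end Automaton

/-- Integer `2 × 2` matrices are coded by the codes of their four entries. -/
instance : Primcodable (Matrix (Fin 2) (Fin 2) ℤ) :=
  inferInstanceAs (Primcodable (Fin 2 → Fin 2 → ℤ))

end GL2Z

/-!
The decision procedure comes from Post's theorem: solvability of the equation and its failure both
have finite witnesses that a primitive recursive predicate recognizes (`computablePred_run`).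

*The equation as a path problem.* Multiplied by `Mₜ` on the right, the equation asks for a path
with product `Mₜ * Mₜ` in a finite graph whose edges are labelled by nonsingular matrices: the
automata are put one behind the other, with `Mᵢ` as the label of the edges that leave the `i`-th one
(`edges`, `run_edges_iff`). The determinants of all products that occur along paths from the start
divide a fixed number `D`. A path with the required product is a witness for solvability.

*Passing to a free group.* Two matrices that have the same determinant `d ∣ D` and agree modulo
`4 * D` differ by a left factor in the principal congruence subgroup of level `4`. This is a
subgroup of the Sanov subgroup, the free group generated by `!![1, 2; 0, 1]` and `!![1, 0; 2, 1]`
(`sanov_injective`, `exists_sanov_mul_eq`). So every product along a path is `g * H`, where `H` is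
one of finitely many representatives, and a step of the path multiplies the free group element `g`
on the right by one of finitely many elements. What remains is to certify that in a finite graph
with labels in a free group there is no path from one vertex to another with a prescribed product.

*Saturation in the free group.* Let the labels be in the ball of radius `m` for the word norm, and
let a set `E` of edges contain the given ones and be closed under those compositions whose labels
stay in the ball. Then `E` contains an edge from `x` to `y` with label `g` for every path from `x`
to `y` whose product `g` is in the ball. The reason is that the Cayley graph is a tree: where the
distance of the partial product from `1` has a local maximum, the two adjacent steps can be replaced
by one step in the ball (`norm_mul_le_of_isLocalMax`), and a path without such maxima never leaves
the ball (`AscendingChain.append_edge`, `AscendingChain.edge_of_norm_le`). Hence a finite saturated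
set that misses the target certifies unsolvability (`IsCertificate.not_run`), and if there is no
solution, the set of all edges that come from actual paths is such a certificate
(`exists_isCertificate`).
-/

namespace GL2Z

/-! ### Cancellation in free groups -/

section FreeGroupMerging

variable {α : Type*}

/-- In the product of two reduced words, a suffix `s` of the first one cancels against the inverse
of `s` at the beginning of the second one, and the remaining word is reduced. -/
theorem exists_cancellation {L₁ L₂ : List (α × Bool)} (h₁ : FreeGroup.IsReduced L₁)
    (h₂ : FreeGroup.IsReduced L₂) :
    ∃ u s v, L₁ = u ++ s ∧ L₂ = FreeGroup.invRev s ++ v ∧ FreeGroup.IsReduced (u ++ v) := by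
  induction L₁ using List.reverseRecOn generalizing L₂ with
  | nil => exact ⟨[], [], L₂, rfl, by simp, by simpa using h₂⟩
  | append_singleton L a ih =>
    cases L₂ with
    | nil => exact ⟨L ++ [a], [], [], by simp, by simp, by simpa using h₁⟩
    | cons b L₂ =>
      by_cases hab : b = (a.1, !a.2)
      · obtain ⟨u, s, v, rfl, rfl, h⟩ := ih (h₁.infix ⟨[], [a], by simp⟩)
          (show FreeGroup.IsReduced L₂ from h₂.infix ⟨[b], [], by simp⟩)
        exact ⟨u, s ++ [a], v, by simp, by simp [FreeGroup.invRev, hab], h⟩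
      · refine ⟨L ++ [a], [], b :: L₂, by simp, by simp, ?_⟩
        unfold FreeGroup.IsReduced at *
        rw [List.isChain_append]
        refine ⟨h₁, h₂, ?_⟩
        rintro x hx y hy hxy
        simp only [List.getLast?_append, List.getLast?_singleton, Option.some_or,
          Option.mem_def, Option.some.injEq, List.head?_cons] at hx hy
        subst hx hy
        by_contra hne
        exact hab (Prod.ext hxy.symm (by cases h : a.2 <;> cases h' : b.2 <;> simp_all))

variable [DecidableEq α]

theorem exists_mk_cancellation (x y : FreeGroup α) :
    ∃ u s v, x.toWord = u ++ s ∧ y = (FreeGroup.mk s)⁻¹ * FreeGroup.mk v ∧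
      y.norm = s.length + v.length ∧ (x * y).norm = u.length + v.length := by
  obtain ⟨u, s, v, hx, hy, h⟩ :=
    exists_cancellation (FreeGroup.isReduced_toWord (x := x)) (FreeGroup.isReduced_toWord (x := y))
  have hy' : y = (FreeGroup.mk s)⁻¹ * FreeGroup.mk v := by
    rw [← FreeGroup.mk_toWord (x := y), hy, FreeGroup.inv_mk, FreeGroup.mul_mk]
  refine ⟨u, s, v, hx, hy', by simp [FreeGroup.norm, hy], ?_⟩
  have hxy : x * y = FreeGroup.mk (u ++ v) := by
    rw [hy', ← FreeGroup.mk_toWord (x := x), hx, ← FreeGroup.mul_mk, ← FreeGroup.mul_mk]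
    group
  rw [hxy, FreeGroup.norm, FreeGroup.toWord_mk, h.reduce_eq, List.length_append]

/-- The tree property of the free group: at a point `p` that is at least as far from `1` as its
neighbours `p * b⁻¹` and `p * c` on a path, the two steps `b` and `c` can be replaced by the single
step `b * c`, which is no longer than the longer of the two. -/
theorem norm_mul_le_of_isLocalMax {p b c : FreeGroup α} (hb : (p * b⁻¹).norm ≤ p.norm)
    (hc : (p * c).norm ≤ p.norm) : (b * c).norm ≤ max b.norm c.norm := by
  obtain ⟨u, s, v, hp, hb', hbn, hpb⟩ := exists_mk_cancellation p b⁻¹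
  obtain ⟨u', s', v', hp', hc', hcn, hpc⟩ := exists_mk_cancellation p c
  have hpn : p.norm = u.length + s.length := by simp [FreeGroup.norm, hp]
  have hpn' : p.norm = u'.length + s'.length := by simp [FreeGroup.norm, hp']
  rw [FreeGroup.norm_inv_eq] at hbn
  have hb'' : b = (FreeGroup.mk v)⁻¹ * FreeGroup.mk s := by
    rw [← inv_inv b, hb']; group
  have hs : s <:+ p.toWord := ⟨u, hp.symm⟩
  have hs' : s' <:+ p.toWord := ⟨u', hp'.symm⟩
  have bound : ∀ l m n : FreeGroup α, (l * m * n).norm ≤ l.norm + m.norm + n.norm := fun l m n =>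
    (FreeGroup.norm_mul_le _ _).trans (Nat.add_le_add_right (FreeGroup.norm_mul_le _ _) _)
  have hv := FreeGroup.norm_mk_le (L₁ := v)
  have hv' := FreeGroup.norm_mk_le (L₁ := v')
  -- `s` and `s'` are the parts of `p` that cancel against `b⁻¹` and `c`; since `p` is a local
  -- maximum, they make up at least half of `b` and of `c`, and the shorter one cancels in `b * c`.
  rcases le_total s.length s'.length with hle | hle
  · obtain ⟨t, rfl⟩ := List.suffix_of_suffix_length_le hs hs' hle
    have h : b * c = (FreeGroup.mk v)⁻¹ * (FreeGroup.mk t)⁻¹ * FreeGroup.mk v' := by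
      rw [hb'', hc', ← FreeGroup.mul_mk]; group
    have ht := FreeGroup.norm_mk_le (L₁ := t)
    have := bound (FreeGroup.mk v)⁻¹ (FreeGroup.mk t)⁻¹ (FreeGroup.mk v')
    rw [← h, FreeGroup.norm_inv_eq, FreeGroup.norm_inv_eq] at this
    simp only [List.length_append] at *
    omega
  · obtain ⟨t, rfl⟩ := List.suffix_of_suffix_length_le hs' hs hle
    have h : b * c = (FreeGroup.mk v)⁻¹ * FreeGroup.mk t * FreeGroup.mk v' := by
      rw [hb'', hc', ← FreeGroup.mul_mk]; group
    have ht := FreeGroup.norm_mk_le (L₁ := t)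
    have := bound (FreeGroup.mk v)⁻¹ (FreeGroup.mk t) (FreeGroup.mk v')
    rw [← h, FreeGroup.norm_inv_eq] at this
    simp only [List.length_append] at *
    omega

/-- Chains of `E`-edges of length at most `m` starting at `x₀`, along which the distance of the
partial product from `1` never decreases. The indices are the product of the labels and the
endpoint. -/
inductive AscendingChain {X : Type*} (E : X → FreeGroup α → X → Prop) (m : ℕ) (x₀ : X) :
    FreeGroup α → X → Prop
  | base {b y} : E x₀ b y → b.norm ≤ m → AscendingChain E m x₀ b y
  | push {p y b z} : AscendingChain E m x₀ p y → E y b z → b.norm ≤ m → p.norm ≤ (p * b).norm →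
      AscendingChain E m x₀ (p * b) z

namespace AscendingChain

variable {X : Type*} {E : X → FreeGroup α → X → Prop} {m : ℕ} {x₀ : X}

/-- If `E` is closed under those compositions whose label stays in the ball of radius `m`, then an
ascending chain extended by one more edge has the same product and endpoint as some ascending
chain: as long as the last point of the chain is a local maximum, merge the last two edges. -/
theorem append_edge
    (hE : ∀ x y z a b, E x a y → E y b z → (a * b).norm ≤ m → E x (a * b) z)
    {p : FreeGroup α} {y : X} (h : AscendingChain E m x₀ p y) :
    ∀ {c z}, E y c z → c.norm ≤ m → AscendingChain E m x₀ (p * c) z := by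
  induction h with
  | @base b y hb hbm =>
    intro c z hc hcm
    by_cases hle : b.norm ≤ (b * c).norm
    · exact push (base hb hbm) hc hcm hle
    · exact base (hE _ _ _ _ _ hb hc (by omega)) (by omega)
  | @push p y b z h hb hbm hpb ih =>
    intro c w hc hcm
    by_cases hle : (p * b).norm ≤ (p * b * c).norm
    · exact push (push h hb hbm hpb) hc hcm hle
    · have hbc : (b * c).norm ≤ m :=
        (norm_mul_le_of_isLocalMax (p := p * b) (by simpa using hpb) (by omega)).trans
          (max_le hbm hcm)
      rw [mul_assoc]
      exact ih (hE _ _ _ _ _ hb hc hbc) hbc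

/-- An ascending chain whose product lies in the ball never leaves the ball, so its edges can be
composed from left to right. -/
theorem edge_of_norm_le
    (hE : ∀ x y z a b, E x a y → E y b z → (a * b).norm ≤ m → E x (a * b) z)
    {p : FreeGroup α} {y : X} (h : AscendingChain E m x₀ p y) : p.norm ≤ m → E x₀ p y := by
  induction h with
  | base hb _ => exact fun _ => hb
  | push _ hb _ hpb ih => exact fun hle => hE _ _ _ _ _ (ih (hpb.trans hle)) hb hle

end AscendingChain

end FreeGroupMerging

/-! ### The Sanov subgroup of `SL(2, ℤ)` -/

section Sanov

open Matrix

/-- The two unipotent matrices that generate the Sanov subgroup. -/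
def sanovGen : Bool → SpecialLinearGroup (Fin 2) ℤ
  | true => ⟨!![1, 2; 0, 1], by simp⟩
  | false => ⟨!![1, 0; 2, 1], by simp⟩

/-- The homomorphism from the free group of rank two onto the Sanov subgroup. -/
def sanov : FreeGroup Bool →* SpecialLinearGroup (Fin 2) ℤ :=
  FreeGroup.lift sanovGen

/-- The image of a letter of a free group word: a generator or its inverse. -/
def sanovLetter (x : Bool × Bool) : SpecialLinearGroup (Fin 2) ℤ :=
  cond x.2 (sanovGen x.1) (sanovGen x.1)⁻¹

theorem coe_sanovLetter_true (s : Bool) :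
    (sanovLetter (true, s) : Matrix (Fin 2) (Fin 2) ℤ) = !![1, cond s 2 (-2); 0, 1] := by
  cases s
  · change ((sanovGen true)⁻¹ : SpecialLinearGroup (Fin 2) ℤ).1 = _
    rw [Matrix.SpecialLinearGroup.coe_inv, Matrix.adjugate_fin_two]
    simp [sanovGen]
  · rfl

theorem coe_sanovLetter_false (s : Bool) :
    (sanovLetter (false, s) : Matrix (Fin 2) (Fin 2) ℤ) = !![1, 0; cond s 2 (-2), 1] := by
  cases s
  · change ((sanovGen false)⁻¹ : SpecialLinearGroup (Fin 2) ℤ).1 = _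
    rw [Matrix.SpecialLinearGroup.coe_inv, Matrix.adjugate_fin_two]
    simp [sanovGen]
  · rfl

/-- The action of the generators and their inverses on integer vectors. -/
def sanovStep : Bool × Bool → ℤ × ℤ → ℤ × ℤ
  | (true, true), v => (v.1 + 2 * v.2, v.2)
  | (true, false), v => (v.1 - 2 * v.2, v.2)
  | (false, true), v => (v.1, v.2 + 2 * v.1)
  | (false, false), v => (v.1, v.2 - 2 * v.1)

/-- The four domains of the ping-pong argument; each is mapped into the domain of a letter by that
letter, unless it is the domain of the inverse letter. -/
def sanovZone : Bool × Bool → ℤ × ℤ → Prop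
  | (true, true), v => (0 < v.2 ∧ v.2 < v.1) ∨ (v.2 < 0 ∧ v.1 < v.2)
  | (true, false), v => (0 < v.2 ∧ v.2 < -v.1) ∨ (v.2 < 0 ∧ -v.1 < v.2)
  | (false, true), v => (0 < v.1 ∧ v.1 < v.2) ∨ (v.1 < 0 ∧ v.2 < v.1)
  | (false, false), v => (0 < v.1 ∧ v.1 < -v.2) ∨ (v.1 < 0 ∧ -v.2 < v.1)

/-- The basis vector that is not fixed by the generator `i`. -/
def sanovBase (i : Bool) : ℤ × ℤ :=
  if i then (0, 1) else (1, 0)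

theorem sanovZone_step_base (x : Bool × Bool) :
    sanovZone x (sanovStep x (sanovBase x.1)) := by
  rcases x with ⟨_ | _, _ | _⟩ <;> simp [sanovZone, sanovStep, sanovBase]

theorem sanovZone_step {x y : Bool × Bool} (hxy : x.1 = y.1 → x.2 = y.2) {v : ℤ × ℤ}
    (hv : sanovZone y v) : sanovZone x (sanovStep x v) := by
  rcases x with ⟨_ | _, _ | _⟩ <;> rcases y with ⟨_ | _, _ | _⟩ <;>
    simp [sanovZone, sanovStep] at hxy hv ⊢ <;> omega

theorem not_sanovZone_base (x : Bool × Bool) (i : Bool) : ¬ sanovZone x (sanovBase i) := by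
  rcases x with ⟨_ | _, _ | _⟩ <;> cases i <;> simp [sanovZone, sanovBase]

/-- A reduced word, applied to the basis vector that its last letter moves, ends up in the domain
of its first letter. -/
theorem exists_sanovZone_foldr (x : Bool × Bool) (L : List (Bool × Bool))
    (h : FreeGroup.IsReduced (x :: L)) :
    ∃ i, sanovZone x ((x :: L).foldr sanovStep (sanovBase i)) := by
  induction L generalizing x with
  | nil => exact ⟨x.1, sanovZone_step_base x⟩
  | cons y L ih =>
    unfold FreeGroup.IsReduced at h ih
    rw [List.isChain_cons_cons] at h
    obtain ⟨i, hi⟩ := ih y h.2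
    exact ⟨i, sanovZone_step h.1 hi⟩

theorem sanovStep_foldr (L : List (Bool × Bool)) (v : ℤ × ℤ) :
    L.foldr sanovStep v =
      ((sanov (FreeGroup.mk L)) 0 0 * v.1 + (sanov (FreeGroup.mk L)) 0 1 * v.2,
        (sanov (FreeGroup.mk L)) 1 0 * v.1 + (sanov (FreeGroup.mk L)) 1 1 * v.2) := by
  induction L with
  | nil => simp [sanov]
  | cons x L ih =>
    have h : sanov (FreeGroup.mk (x :: L)) =
        sanovLetter x * sanov (FreeGroup.mk L) := by
      simp [sanov, FreeGroup.lift_mk, sanovLetter]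
    rw [List.foldr_cons, ih, h]
    rcases x with ⟨_ | _, _ | _⟩ <;>
      simp [sanovStep, coe_sanovLetter_true, coe_sanovLetter_false, Matrix.mul_apply,
        Fin.sum_univ_two] <;> ring

theorem sanov_injective : Function.Injective sanov := by
  rw [injective_iff_map_eq_one]
  intro g hg
  by_contra hne
  have hw : g.toWord ≠ [] := fun h => hne (FreeGroup.toWord_eq_nil_iff.mp h)
  obtain ⟨x, L, hL⟩ := List.exists_cons_of_ne_nil hw
  obtain ⟨i, hi⟩ := exists_sanovZone_foldr x L (hL ▸ FreeGroup.isReduced_toWord)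
  rw [← hL, sanovStep_foldr, FreeGroup.mk_toWord, hg] at hi
  exact not_sanovZone_base x i (by simpa using hi)

theorem mem_range_sanov_of_letter_mul {x : Bool × Bool} {A : SpecialLinearGroup (Fin 2) ℤ}
    (h : sanovLetter x * A ∈ sanov.range) : A ∈ sanov.range := by
  have hi : sanovGen x.1 ∈ sanov.range := ⟨FreeGroup.of x.1, by simp [sanov]⟩
  refine (Subgroup.mul_mem_cancel_left _ ?_).mp h
  rcases x with ⟨i, _ | _⟩
  · exact inv_mem hi
  · exact hi

theorem mem_range_sanov_of_upper (n : ℕ) : ∀ A : SpecialLinearGroup (Fin 2) ℤ,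
    (A 0 1).natAbs ≤ n → A 0 0 = 1 → A 1 1 = 1 → A 0 1 % 2 = 0 → A 1 0 = 0 →
      A ∈ sanov.range := by
  induction n with
  | zero =>
    intro A hn ha hd hb hc
    have hA : A = 1 := by
      ext i j
      fin_cases i <;> fin_cases j <;> simp [ha, hd, hc]
      omega
    exact hA ▸ one_mem _
  | succ n ih =>
    intro A hn ha hd hb hc
    by_cases h0 : A 0 1 = 0
    · exact ih A (by omega) ha hd hb hc
    · have h00 (s) : (sanovLetter (true, s) * A) 0 0 = A 0 0 + cond s 2 (-2) * A 1 0 := by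
        simp [coe_sanovLetter_true, Matrix.mul_apply, Fin.sum_univ_two]
      have h01 (s) : (sanovLetter (true, s) * A) 0 1 = A 0 1 + cond s 2 (-2) * A 1 1 := by
        simp [coe_sanovLetter_true, Matrix.mul_apply, Fin.sum_univ_two]
      have h10 (s) : (sanovLetter (true, s) * A) 1 0 = A 1 0 := by
        simp [coe_sanovLetter_true, Matrix.mul_apply, Fin.sum_univ_two]
      have h11 (s) : (sanovLetter (true, s) * A) 1 1 = A 1 1 := by
        simp [coe_sanovLetter_true, Matrix.mul_apply, Fin.sum_univ_two]
      rcases lt_or_gt_of_ne h0 with h | h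
      · apply mem_range_sanov_of_letter_mul (x := (true, true))
        apply ih <;> simp only [h00, h01, h10, h11, cond_true] <;> omega
      · apply mem_range_sanov_of_letter_mul (x := (true, false))
        apply ih <;> simp only [h00, h01, h10, h11, cond_false] <;> omega

/-- Euclid's algorithm with quotients `±2` on the first column: its entries have different parity,
so as long as neither is zero, the one of larger absolute value can be made smaller. -/
theorem mem_range_sanov_of_column_le (n : ℕ) : ∀ A : SpecialLinearGroup (Fin 2) ℤ,
    (A 0 0).natAbs + (A 1 0).natAbs ≤ n →
    A 0 0 % 4 = 1 → A 1 1 % 4 = 1 → A 0 1 % 2 = 0 → A 1 0 % 2 = 0 → A ∈ sanov.range := by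
  induction n with
  | zero => intro A hn ha; omega
  | succ n ih =>
    intro A hn ha hd hb hc
    have hdet := A.2
    rw [Matrix.det_fin_two] at hdet
    by_cases hc0 : A 1 0 = 0
    · have hu : A 0 0 = 1 ∨ A 0 0 = -1 :=
        Int.isUnit_iff.mp (IsUnit.of_mul_eq_one (A 1 1) (by simpa [hc0] using hdet))
      have ha1 : A 0 0 = 1 := by omega
      refine mem_range_sanov_of_upper _ A le_rfl ha1 ?_ hb hc0
      simpa [hc0, ha1] using hdet
    have h00 (s) : (sanovLetter (true, s) * A) 0 0 = A 0 0 + cond s 2 (-2) * A 1 0 := by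
      simp [coe_sanovLetter_true, Matrix.mul_apply, Fin.sum_univ_two]
    have h01 (s) : (sanovLetter (true, s) * A) 0 1 = A 0 1 + cond s 2 (-2) * A 1 1 := by
      simp [coe_sanovLetter_true, Matrix.mul_apply, Fin.sum_univ_two]
    have h10 (s) : (sanovLetter (true, s) * A) 1 0 = A 1 0 := by
      simp [coe_sanovLetter_true, Matrix.mul_apply, Fin.sum_univ_two]
    have h11 (s) : (sanovLetter (true, s) * A) 1 1 = A 1 1 := by
      simp [coe_sanovLetter_true, Matrix.mul_apply, Fin.sum_univ_two]
    have k00 (s) : (sanovLetter (false, s) * A) 0 0 = A 0 0 := by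
      simp [coe_sanovLetter_false, Matrix.mul_apply, Fin.sum_univ_two]
    have k01 (s) : (sanovLetter (false, s) * A) 0 1 = A 0 1 := by
      simp [coe_sanovLetter_false, Matrix.mul_apply, Fin.sum_univ_two]
    have k10 (s) : (sanovLetter (false, s) * A) 1 0 = A 1 0 + cond s 2 (-2) * A 0 0 := by
      simp [coe_sanovLetter_false, Matrix.mul_apply, Fin.sum_univ_two, add_comm]
    have k11 (s) : (sanovLetter (false, s) * A) 1 1 = A 1 1 + cond s 2 (-2) * A 0 1 := by
      simp [coe_sanovLetter_false, Matrix.mul_apply, Fin.sum_univ_two, add_comm]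
    clear hdet
    by_cases hs : (A 0 0 < 0 ↔ A 1 0 < 0)
    · by_cases hlt : (A 1 0).natAbs < (A 0 0).natAbs
      · apply mem_range_sanov_of_letter_mul (x := (true, false))
        apply ih <;> simp only [h00, h01, h10, h11, cond_false] <;> omega
      · apply mem_range_sanov_of_letter_mul (x := (false, false))
        apply ih <;> simp only [k00, k01, k10, k11, cond_false] <;> omega
    · by_cases hlt : (A 1 0).natAbs < (A 0 0).natAbs
      · apply mem_range_sanov_of_letter_mul (x := (true, true))
        apply ih <;> simp only [h00, h01, h10, h11, cond_true] <;> omega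
      · apply mem_range_sanov_of_letter_mul (x := (false, true))
        apply ih <;> simp only [k00, k01, k10, k11, cond_true] <;> omega

/-- The free group element is recovered from `V` and `H` alone: matrices of equal nonzero
determinant `d ∣ D` that agree modulo `4 * D` differ by a left factor congruent to `1` modulo `4`,
and the principal congruence subgroup of level `4` is contained in the Sanov subgroup. -/
theorem exists_sanov_mul_eq {V H : Matrix (Fin 2) (Fin 2) ℤ} {D : ℤ} (hdet : V.det = H.det)
    (h0 : H.det ≠ 0) (hD : H.det ∣ D) (hmod : ∀ i j, 4 * D ∣ V i j - H i j) :
    ∃ x : FreeGroup Bool, V = (sanov x : Matrix (Fin 2) (Fin 2) ℤ) * H := by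
  obtain ⟨k, hk⟩ := hD
  choose Q hQ using hmod
  have hV : V = H + (4 * D) • Matrix.of Q := by
    ext i j
    simp only [Matrix.add_apply, Matrix.smul_apply, Matrix.of_apply, smul_eq_mul, ← hQ]
    ring
  -- As `H⁻¹ = d⁻¹ • H.adjugate`, the quotient `V * H⁻¹` is `1 + 4 * (D / d) • (Q * H.adjugate)`.
  set Z : Matrix (Fin 2) (Fin 2) ℤ := Matrix.of Q * H.adjugate with hZ
  have hgH : (1 + (4 * k) • Z) * H = V := by
    rw [add_mul, one_mul, Matrix.smul_mul, hZ, Matrix.mul_assoc, Matrix.adjugate_mul, hV, hk,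
      Matrix.mul_smul, Matrix.mul_one, smul_smul]
    congr 2
    ring
  have hg : (1 + (4 * k) • Z).det = 1 := by
    have := congrArg Matrix.det hgH
    rw [Matrix.det_mul, hdet] at this
    exact mul_right_cancel₀ h0 (this.trans (one_mul _).symm)
  have hmem : (⟨1 + (4 * k) • Z, hg⟩ : SpecialLinearGroup (Fin 2) ℤ) ∈ sanov.range := by
    have e (i j) : (1 + (4 * k) • Z) i j =
        (1 : Matrix (Fin 2) (Fin 2) ℤ) i j + 4 * (k * Z i j) := by
      simp only [Matrix.add_apply, Matrix.smul_apply, smul_eq_mul, mul_assoc]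
    refine mem_range_sanov_of_column_le _ _ le_rfl ?_ ?_ ?_ ?_ <;>
      simp only [e, Matrix.one_apply_eq, Matrix.one_apply_ne, ne_eq,
        zero_ne_one, one_ne_zero, not_false_eq_true] <;> omega
  obtain ⟨x, hx⟩ := hmem
  exact ⟨x, by rw [hx, hgH]⟩

end Sanov

/-! ### Runs in graphs labelled by matrices -/

/-- Integer `2 × 2` matrices. -/
abbrev Mat : Type := Matrix (Fin 2) (Fin 2) ℤ

section Runs

variable {P : Type*}

/-- `Run G p V q` says that the labels along some path from `p` to `q` in the graph with edge list
`G` have the product `V`. -/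
inductive Run (G : List (P × Mat × P)) (p : P) : Mat → P → Prop
  | nil : Run G p 1 p
  | snoc {V q v r} : Run G p V q → (q, v, r) ∈ G → Run G p (V * v) r

theorem Run.trans {G : List (P × Mat × P)} {p q r : P} {V W : Mat} (h₁ : Run G p V q)
    (h₂ : Run G q W r) : Run G p (V * W) r := by
  induction h₂ with
  | nil => simpa using h₁
  | snoc _ he ih => rw [← mul_assoc]; exact ih.snoc he

theorem Run.single {G : List (P × Mat × P)} {p q : P} {v : Mat} (h : (p, v, q) ∈ G) :
    Run G p v q := by
  simpa using Run.nil.snoc h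

/-- The pairs (endpoint, product of labels) of the paths with `k` edges that start at `s`. -/
def reach [DecidableEq P] (G : List (P × Mat × P)) (s : P) (k : ℕ) : List (P × Mat) :=
  (fun L => L.flatMap fun y => (G.filter fun e => y.1 = e.1).map fun e => (e.2.2, y.2 * e.2.1))^[k]
    [(s, 1)]

theorem run_iff_exists_mem_reach [DecidableEq P] {G : List (P × Mat × P)} {s : P} {y : P × Mat} :
    Run G s y.2 y.1 ↔ ∃ k, y ∈ reach G s k := by
  have hsucc (k : ℕ) (y : P × Mat) : y ∈ reach G s (k + 1) ↔
      ∃ x ∈ reach G s k, ∃ e ∈ G, x.1 = e.1 ∧ (e.2.2, x.2 * e.2.1) = y := by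
    simp only [reach, Function.iterate_succ', Function.comp_apply, List.mem_flatMap, List.mem_map,
      List.mem_filter, decide_eq_true_eq, and_assoc]
  constructor
  · have key {V : Mat} {p : P} (h : Run G s V p) : ∃ k, (p, V) ∈ reach G s k := by
      induction h with
      | nil => exact ⟨0, by simp [reach]⟩
      | @snoc V q v r _ he ih =>
        obtain ⟨k, hk⟩ := ih
        exact ⟨k + 1, (hsucc _ _).mpr ⟨_, hk, _, he, rfl, rfl⟩⟩
    exact key
  · rintro ⟨k, hk⟩
    induction k generalizing y with
    | zero =>
      simp only [reach, Function.iterate_zero, id_eq, List.mem_singleton] at hk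
      exact hk ▸ Run.nil
    | succ k ih =>
      obtain ⟨x, hx, ⟨q, v, r⟩, he, hq, rfl⟩ := (hsucc _ _).mp hk
      have hx' := ih hx
      rw [hq] at hx'
      exact hx'.snoc he

end Runs

/-! ### Certificates for the absence of runs -/

section Certificates

/-- The matrices of the four one-letter words of the free group. -/
def sanovLetters : List Mat :=
  [!![1, 2; 0, 1], !![1, -2; 0, 1], !![1, 0; 2, 1], !![1, 0; -2, 1]]

/-- The matrices of the free group elements of norm at most `m`. -/
def ball (m : ℕ) : List Mat :=
  (fun L => L ++ L.flatMap fun g => sanovLetters.map fun h => g * h)^[m] [1]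

theorem mem_sanovLetters {A : Mat} :
    A ∈ sanovLetters ↔ ∃ x : Bool × Bool, (sanovLetter x : Mat) = A := by
  simp only [Prod.exists, Bool.exists_bool, coe_sanovLetter_true, coe_sanovLetter_false,
    sanovLetters, List.mem_cons, List.not_mem_nil, or_false, cond_true, cond_false]
  grind

theorem sanov_mk_singleton (x : Bool × Bool) : sanov (FreeGroup.mk [x]) = sanovLetter x := by
  simp [sanov, FreeGroup.lift_mk, sanovLetter]

theorem mem_ball {m : ℕ} {g : Mat} :
    g ∈ ball m ↔ ∃ x : FreeGroup Bool, x.norm ≤ m ∧ (sanov x : Mat) = g := by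
  induction m generalizing g with
  | zero => simp [ball, eq_comm]
  | succ m ih =>
    have hsucc : g ∈ ball (m + 1) ↔ g ∈ ball m ∨ ∃ a ∈ ball m, ∃ b ∈ sanovLetters, a * b = g := by
      simp only [ball, Function.iterate_succ', Function.comp_apply, List.mem_append,
        List.mem_flatMap, List.mem_map]
    rw [hsucc, ih]
    constructor
    · rintro (⟨x, hx, rfl⟩ | ⟨a, ha, b, hb, rfl⟩)
      · exact ⟨x, by omega, rfl⟩
      · obtain ⟨x, hx, rfl⟩ := ih.mp ha
        obtain ⟨c, rfl⟩ := mem_sanovLetters.mp hb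
        refine ⟨x * FreeGroup.mk [c], (FreeGroup.norm_mul_le _ _).trans
          (add_le_add hx FreeGroup.norm_mk_le), ?_⟩
        rw [map_mul, sanov_mk_singleton, Matrix.SpecialLinearGroup.coe_mul]
    · rintro ⟨x, hx, rfl⟩
      rcases List.eq_nil_or_concat x.toWord with h | ⟨w, c, h⟩
      · rw [FreeGroup.toWord_eq_nil_iff] at h
        exact Or.inl ⟨x, by simp [h], rfl⟩
      · rw [List.concat_eq_append] at h
        have hxw : x = FreeGroup.mk w * FreeGroup.mk [c] := by
          rw [FreeGroup.mul_mk, ← h, FreeGroup.mk_toWord]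
        have hlen : w.length ≤ m := by
          simpa [FreeGroup.norm, h] using hx
        refine Or.inr ⟨_, ih.mpr ⟨FreeGroup.mk w, FreeGroup.norm_mk_le.trans hlen, rfl⟩, _,
          mem_sanovLetters.mpr ⟨c, rfl⟩, ?_⟩
        rw [hxw, map_mul, sanov_mk_singleton, Matrix.SpecialLinearGroup.coe_mul]

/-- Congruence of matrices modulo `N`. -/
def Cong (N : ℕ) (A B : Mat) : Prop :=
  ∀ i j, (N : ℤ) ∣ A i j - B i j

theorem Cong.trans {N : ℕ} {A B C : Mat} (h₁ : Cong N A B) (h₂ : Cong N B C) : Cong N A C :=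
  fun i j => by simpa using dvd_add (h₁ i j) (h₂ i j)

theorem Cong.symm {N : ℕ} {A B : Mat} (h : Cong N A B) : Cong N B A :=
  fun i j => (dvd_sub_comm).mp (h i j)

theorem Cong.mul_right {N : ℕ} {A B : Mat} (h : Cong N A B) (C : Mat) : Cong N (A * C) (B * C) := by
  intro i j
  have : (A * C) i j - (B * C) i j = (A i 0 - B i 0) * C 0 j + (A i 1 - B i 1) * C 1 j := by
    simp only [Matrix.mul_apply, Fin.sum_univ_two]
    ring
  rw [this]
  exact dvd_add ((h i 0).mul_right _) ((h i 1).mul_right _)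

theorem Cong.det_dvd {N : ℕ} {A B : Mat} (h : Cong N A B) : (N : ℤ) ∣ A.det - B.det := by
  have h' (i j) : B i j ≡ A i j [ZMOD N] := Int.modEq_iff_dvd.mpr (h i j)
  rw [Matrix.det_fin_two, Matrix.det_fin_two, ← Int.modEq_iff_dvd]
  exact ((h' 0 0).mul (h' 1 1)).sub ((h' 0 1).mul (h' 1 0))

/-- If the determinants divide `D`, congruence modulo `4 * D` implies that the determinants agree,
so that the matrices differ by a factor from the Sanov subgroup. -/
theorem Cong.exists_sanov {D : ℕ} (hD : D ≠ 0) {V H : Mat} (h : Cong (4 * D) V H)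
    (hV : V.det ∣ D) (hH : H.det ∣ D) : ∃ x : FreeGroup Bool, V = (sanov x : Mat) * H := by
  have hD' : (0 : ℤ) < D := by exact_mod_cast Nat.pos_of_ne_zero hD
  have bound {d : ℤ} (hd : d ∣ D) : |d| ≤ D := Int.le_of_dvd hD' ((abs_dvd _ _).mpr hd)
  -- The determinants agree modulo `4 * D` and have absolute value at most `D`.
  have hdet : V.det - H.det = 0 := by
    refine Int.eq_zero_of_abs_lt_dvd h.det_dvd ?_
    have := bound hV
    have := bound hH
    have := abs_sub V.det H.det
    push_cast
    omega
  refine exists_sanov_mul_eq (D := D) (sub_eq_zero.mp hdet) ?_ hH ?_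
  · rintro h0
    rw [h0, zero_dvd_iff] at hH
    omega
  · exact fun i j => by exact_mod_cast h i j

variable {P : Type*}

/-- A finite certificate that no path from `s` to `t` in the graph `G` has the product `T`.

A node `(p, H)` stands for all paths from `s` to `p` with a product `g * H`, where `g` is in the
Sanov subgroup. An element `((p, H), g, (p', H'))` of `E` stands for the possibility of a path from
`p` to `p'` whose product `W` satisfies `H * W = g * H'`. The set `E` has to be closed under those
compositions whose labels stay in the ball of radius `m`. The congruences modulo `N` guarantee that
the end of a path with product `T` lies over a node from which `T` is reached by a label in that
ball. -/
structure IsCertificate (G : List (P × Mat × P)) (s t : P) (T : Mat) (m N : ℕ)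
    (nodes : List (P × Mat)) (E : List ((P × Mat) × Mat × (P × Mat))) : Prop where
  start_mem : (s, 1) ∈ nodes
  label_mem : ∀ x ∈ E, x.2.1 ∈ ball m
  comp_mem : ∀ x ∈ E, ∀ y ∈ E, x.2.2 = y.1 → x.2.1 * y.2.1 ∈ ball m →
    (x.1, x.2.1 * y.2.1, y.2.2) ∈ E
  exists_edge : ∀ y ∈ nodes, ∀ e ∈ G, e.1 = y.1 → ∃ x ∈ E, x.1 = y ∧ x.2.2 ∈ nodes ∧
    x.2.2.1 = e.2.2 ∧ y.2 * e.2.1 = x.2.1 * x.2.2.2 ∧ Cong N (y.2 * e.2.1) x.2.2.2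
  target_mem : ∀ y ∈ nodes, y.1 = t → Cong N y.2 T → ∃ g ∈ ball m, g * y.2 = T
  not_target : ∀ x ∈ E, x.1 = (s, 1) → x.2.2.1 = t → x.2.1 * x.2.2.2 ≠ T

theorem mul_right_cancel_of_det_ne_zero {A B H : Mat} (hH : H.det ≠ 0) (h : A * H = B * H) :
    A = B := by
  have := congrArg (· * H.adjugate) h
  simp only [Matrix.mul_assoc, Matrix.mul_adjugate, Matrix.mul_smul, Matrix.mul_one] at this
  exact smul_right_injective _ hH this

theorem IsCertificate.comp_sanov {G : List (P × Mat × P)} {s t : P} {T : Mat} {m N : ℕ}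
    {nodes : List (P × Mat)} {E : List ((P × Mat) × Mat × (P × Mat))}
    (h : IsCertificate G s t T m N nodes E) (y z w : P × Mat) (a b : FreeGroup Bool)
    (ha : (y, (sanov a : Mat), z) ∈ E) (hb : (z, (sanov b : Mat), w) ∈ E)
    (hab : (a * b).norm ≤ m) : (y, (sanov (a * b) : Mat), w) ∈ E := by
  rw [map_mul, Matrix.SpecialLinearGroup.coe_mul]
  refine h.comp_mem _ ha _ hb rfl (mem_ball.mpr ⟨_, hab, ?_⟩)
  rw [map_mul, Matrix.SpecialLinearGroup.coe_mul]

/-- Every run is shadowed by edges of the certificate, which by the tree property of the free group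
combine to an ascending chain with the same product. -/
theorem IsCertificate.exists_chain {G : List (P × Mat × P)} {s t : P} {T : Mat} {m N : ℕ}
    {nodes : List (P × Mat)} {E : List ((P × Mat) × Mat × (P × Mat))}
    (h : IsCertificate G s t T m N nodes E) {V : Mat} {p : P} (hV : Run G s V p) :
    (V = 1 ∧ p = s) ∨ ∃ x H,
      AscendingChain (fun y a z => (y, (sanov a : Mat), z) ∈ E) m (s, 1) x (p, H) ∧
      (p, H) ∈ nodes ∧ V = (sanov x : Mat) * H ∧ Cong N V H := by
  induction hV with
  | nil => exact Or.inl ⟨rfl, rfl⟩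
  | @snoc V q v r hV he ih =>
    right
    rcases ih with ⟨rfl, rfl⟩ | ⟨x, H, hx, hmem, hVH, hcong⟩
    · obtain ⟨⟨y, g, ⟨r', H⟩⟩, hE, rfl, hmem, hr, hg, hc⟩ :=
        h.exists_edge _ h.start_mem _ he rfl
      dsimp only at hr hg hc hmem hE
      subst hr
      obtain ⟨a, ha, rfl⟩ := mem_ball.mp (h.label_mem _ hE)
      exact ⟨a, H, .base hE ha, hmem, hg, hc⟩
    · obtain ⟨⟨y, g, ⟨r', H'⟩⟩, hE, rfl, hmem', hr, hg, hc⟩ := h.exists_edge _ hmem _ he rfl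
      dsimp only at hr hg hc hmem' hE
      subst hr
      obtain ⟨a, ha, rfl⟩ := mem_ball.mp (h.label_mem _ hE)
      refine ⟨x * a, H', hx.append_edge h.comp_sanov hE ha, hmem', ?_, (hcong.mul_right v).trans hc⟩
      rw [hVH, Matrix.mul_assoc, hg, map_mul, Matrix.SpecialLinearGroup.coe_mul, Matrix.mul_assoc]

theorem IsCertificate.not_run {G : List (P × Mat × P)} {s t : P} {T : Mat} {m N : ℕ}
    {nodes : List (P × Mat)} {E : List ((P × Mat) × Mat × (P × Mat))}
    (h : IsCertificate G s t T m N nodes E) (hst : s ≠ t) (hT : T.det ≠ 0) : ¬ Run G s T t := by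
  intro hrun
  rcases h.exists_chain hrun with ⟨-, rfl⟩ | ⟨x, H, hx, hmem, hTH, hcong⟩
  · exact hst rfl
  obtain ⟨g, hg, hgH⟩ := h.target_mem _ hmem rfl hcong.symm
  obtain ⟨x', hx', rfl⟩ := mem_ball.mp hg
  have hH : H.det ≠ 0 := by
    rintro h0
    rw [hTH, Matrix.det_mul, h0, mul_zero] at hT
    exact hT rfl
  have hxx : x = x' := sanov_injective
    (Subtype.ext (mul_right_cancel_of_det_ne_zero hH (hTH.symm.trans hgH.symm)))
  have hE := hx.edge_of_norm_le h.comp_sanov (hxx ▸ hx')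
  exact h.not_target _ hE rfl rfl hTH.symm

theorem ball_eventually {g : Mat} (x : FreeGroup Bool) (h : (sanov x : Mat) = g) :
    ∀ᶠ m in Filter.atTop, g ∈ ball m :=
  Filter.eventually_atTop.mpr ⟨x.norm, fun _ hm => mem_ball.mpr ⟨x, hm, h⟩⟩

/-- The positions and the residues of the products of runs take only finitely many values. -/
theorem exists_finite_representatives (G : List (P × Mat × P)) (s : P) {N : ℕ} (hN : N ≠ 0) :
    ∃ S : Set (P × Mat), S.Finite ∧ (∀ y ∈ S, Run G s y.2 y.1) ∧
      ∀ V p, Run G s V p → ∃ H, (p, H) ∈ S ∧ Cong N V H := by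
  classical
  have : NeZero N := ⟨hN⟩
  let R : Set (P × Mat) := {y | Run G s y.2 y.1}
  let f : P × Mat → P × (Fin 2 → Fin 2 → ZMod N) := fun y => (y.1, fun i j => (y.2 i j : ZMod N))
  obtain ⟨S, hSR, hS⟩ := Set.exists_subset_bijOn R f
  have himage : (f '' R).Finite := by
    refine Set.Finite.subset
      ((((G.map fun e => e.2.2).toFinset ∪ {s}).finite_toSet).prod Set.finite_univ) ?_
    rintro _ ⟨⟨p, V⟩, hV, rfl⟩
    refine ⟨?_, Set.mem_univ _⟩
    change Run G s V p at hV
    cases hV with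
    | nil => simp [f]
    | @snoc _ q v _ _ he =>
      refine Finset.mem_union_left _ (List.mem_toFinset.mpr ?_)
      exact List.mem_map.mpr ⟨_, he, rfl⟩
  refine ⟨S, (hS.finite_iff_finite).mpr himage, fun y hy => hSR hy, fun V p hV => ?_⟩
  obtain ⟨⟨p', H⟩, hH, hf⟩ := hS.surjOn ⟨(p, V), hV, rfl⟩
  obtain ⟨rfl, hf⟩ := Prod.ext_iff.mp hf
  refine ⟨H, hH, fun i j => ?_⟩
  exact (ZMod.intCast_eq_intCast_iff_dvd_sub _ _ _).mp (congrFun (congrFun hf i) j)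

/-- If the determinants of the products of runs divide a fixed number, certificates exist: the nodes
represent the positions and residues of runs, and `E` consists of all edges that are witnessed by
runs and have a label in a sufficiently large ball. -/
theorem exists_isCertificate {G : List (P × Mat × P)} {s t : P} {T : Mat} {D : ℕ} (hD : D ≠ 0)
    (hG : ∀ p V, Run G s V p → V.det ∣ D) (hT : T.det ∣ D) (hrun : ¬ Run G s T t) :
    ∃ m N nodes E, IsCertificate G s t T m N nodes E := by
  classical
  obtain ⟨S, hSfin, hSrun, hS⟩ := exists_finite_representatives G s (N := 4 * D) (by omega)
  set S' : Set (P × Mat) := insert (s, 1) S with hS'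
  have hS'fin : S'.Finite := hSfin.insert _
  have hS'run : ∀ y ∈ S', Run G s y.2 y.1 := by
    rintro y (rfl | hy)
    · exact .nil
    · exact hSrun y hy
  have hedge : ∀ᶠ m in Filter.atTop, ∀ y ∈ S', ∀ e ∈ {e | e ∈ G}, e.1 = y.1 →
      ∃ H g, (e.2.2, H) ∈ S' ∧ g ∈ ball m ∧ y.2 * e.2.1 = g * H ∧
        Cong (4 * D) (y.2 * e.2.1) H := by
    refine (Filter.eventually_all_finite hS'fin).mpr fun y hy =>
      (Filter.eventually_all_finite (List.finite_toSet G)).mpr fun e he => ?_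
    by_cases hey : e.1 = y.1
    · have hstep : Run G s (y.2 * e.2.1) e.2.2 := (hS'run y hy).snoc (hey ▸ he)
      obtain ⟨H, hH, hc⟩ := hS _ _ hstep
      obtain ⟨x, hx⟩ := hc.exists_sanov hD (hG _ _ hstep) (hG _ _ (hSrun _ hH))
      filter_upwards [ball_eventually x rfl] with m hm _
      exact ⟨H, _, Or.inr hH, hm, hx, hc⟩
    · exact Filter.Eventually.of_forall fun _ h => absurd h hey
  have htarget : ∀ᶠ m in Filter.atTop, ∀ y ∈ S', Cong (4 * D) y.2 T →
      ∃ g ∈ ball m, g * y.2 = T := by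
    refine (Filter.eventually_all_finite hS'fin).mpr fun y hy => ?_
    by_cases hc : Cong (4 * D) y.2 T
    · obtain ⟨x, hx⟩ := hc.symm.exists_sanov hD hT (hG _ _ (hS'run y hy))
      filter_upwards [ball_eventually x rfl] with m hm _
      exact ⟨_, hm, hx.symm⟩
    · exact Filter.Eventually.of_forall fun _ h => absurd h hc
  obtain ⟨m, hm, hm'⟩ := (hedge.and htarget).exists
  let E : Set ((P × Mat) × Mat × (P × Mat)) :=
    {x | (x.1 ∈ S' ∧ x.2.1 ∈ ball m ∧ x.2.2 ∈ S') ∧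
      ∃ W, Run G x.1.1 W x.2.2.1 ∧ x.1.2 * W = x.2.1 * x.2.2.2}
  have hE : E.Finite :=
    (hS'fin.prod ((List.finite_toSet (ball m)).prod hS'fin)).subset fun x hx => hx.1
  refine ⟨m, 4 * D, hS'fin.toFinset.toList, hE.toFinset.toList, ?_, ?_, ?_, ?_, ?_, ?_⟩ <;>
    simp only [Finset.mem_toList, Set.Finite.mem_toFinset]
  · exact Or.inl rfl
  · exact fun x hx => hx.1.2.1
  · rintro ⟨y, g, z⟩ ⟨⟨hy, -, -⟩, W, hW, hgW⟩ ⟨z', g', w⟩ ⟨⟨-, -, hw⟩, W', hW', hgW'⟩ rfl hgg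
    refine ⟨⟨hy, hgg, hw⟩, W * W', hW.trans hW', ?_⟩
    dsimp only at hgW hgW' ⊢
    rw [← Matrix.mul_assoc, hgW, Matrix.mul_assoc, hgW', Matrix.mul_assoc]
  · rintro y hy ⟨q, v, r⟩ he rfl
    obtain ⟨H, g, hH, hg, hgH, hc⟩ := hm y hy _ he rfl
    exact ⟨(y, g, (r, H)), ⟨⟨hy, hg, hH⟩, v, .single he, hgH⟩, rfl, hH, rfl, hgH, hc⟩
  · exact fun y hy _ hc => hm' y hy hc
  · rintro ⟨y, g, ⟨q, H⟩⟩ ⟨-, W, hW, hgW⟩ rfl rfl hgT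
    dsimp only at hW hgW hgT
    rw [Matrix.one_mul] at hgW
    exact hrun ((hgW.trans hgT) ▸ hW)

end Certificates

/-! ### Primitive recursive integer and matrix arithmetic -/

section Primitive

variable {α β γ : Type*} [Primcodable α] [Primcodable β] [Primcodable γ]

theorem encode_int_ofNat (n : ℕ) : Encodable.encode (Int.ofNat n) = 2 * n := rfl

theorem encode_int_negSucc (n : ℕ) : Encodable.encode (Int.negSucc n) = 2 * n + 1 := rfl

/-- The bridge from `ℕ` to `ℤ`: the ring operations below write their arguments as differences
of natural numbers and return such a difference. -/
theorem primrec_subNatNat : Primrec₂ Int.subNatNat := by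
  refine Primrec₂.encode_iff.mp (Primrec.of_eq
    (f := fun p : ℕ × ℕ => if p.2 ≤ p.1 then 2 * (p.1 - p.2) else 2 * (p.2 - p.1 - 1) + 1) ?_ ?_)
  · refine Primrec.ite (Primrec.nat_le.comp .snd .fst)
      (Primrec.nat_double.comp (Primrec.nat_sub.comp .fst .snd))
      (Primrec.nat_double_succ.comp (Primrec.nat_sub.comp (Primrec.nat_sub.comp .snd .fst)
        (.const 1)))
  · rintro ⟨m, n⟩
    dsimp only
    split_ifs with h
    · rw [Int.subNatNat_of_le h]
      rfl
    · obtain ⟨k, rfl⟩ := Nat.exists_eq_add_of_lt (not_le.mp h)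
      rw [Int.subNatNat_of_lt (by omega)]
      exact (congrArg (2 * · + 1) (by simp)).trans (encode_int_negSucc _).symm

theorem primrec_toNat : Primrec Int.toNat := by
  refine Primrec.of_eq (f := fun z : ℤ => if Encodable.encode z % 2 = 0 then
    Encodable.encode z / 2 else 0) ?_ ?_
  · exact Primrec.ite (Primrec.eq.comp (Primrec.nat_mod.comp .encode (.const 2)) (.const 0))
      (Primrec.nat_div.comp .encode (.const 2)) (.const 0)
  · rintro (n | n)
    · rw [encode_int_ofNat]; simp
    · rw [encode_int_negSucc]; simp

theorem primrec_toNat_neg : Primrec fun z : ℤ => (-z).toNat := by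
  refine Primrec.of_eq (f := fun z : ℤ => if Encodable.encode z % 2 = 0 then 0 else
    Encodable.encode z / 2 + 1) ?_ ?_
  · exact Primrec.ite (Primrec.eq.comp (Primrec.nat_mod.comp .encode (.const 2)) (.const 0))
      (.const 0) (Primrec.succ.comp (Primrec.nat_div.comp .encode (.const 2)))
  · rintro (n | n)
    · rw [encode_int_ofNat]; simp
    · rw [encode_int_negSucc]; simp; omega

theorem primrec_int_add : Primrec₂ ((· + ·) : ℤ → ℤ → ℤ) := by
  have pos := primrec_toNat
  have neg := primrec_toNat_neg
  refine Primrec.of_eq (primrec_subNatNat.comp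
    (Primrec.nat_add.comp (pos.comp .fst) (pos.comp .snd))
    (Primrec.nat_add.comp (neg.comp .fst) (neg.comp .snd))) fun ⟨a, b⟩ => ?_
  rw [Int.subNatNat_eq_coe]
  push_cast
  have := Int.toNat_sub_toNat_neg a
  have := Int.toNat_sub_toNat_neg b
  omega

theorem primrec_int_sub : Primrec₂ ((· - ·) : ℤ → ℤ → ℤ) := by
  have pos := primrec_toNat
  have neg := primrec_toNat_neg
  refine Primrec.of_eq (primrec_subNatNat.comp
    (Primrec.nat_add.comp (pos.comp .fst) (neg.comp .snd))
    (Primrec.nat_add.comp (neg.comp .fst) (pos.comp .snd))) fun ⟨a, b⟩ => ?_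
  rw [Int.subNatNat_eq_coe]
  push_cast
  have := Int.toNat_sub_toNat_neg a
  have := Int.toNat_sub_toNat_neg b
  omega

theorem primrec_int_mul : Primrec₂ ((· * ·) : ℤ → ℤ → ℤ) := by
  have pos := primrec_toNat
  have neg := primrec_toNat_neg
  refine Primrec.of_eq (primrec_subNatNat.comp
    (Primrec.nat_add.comp (Primrec.nat_mul.comp (pos.comp .fst) (pos.comp .snd))
      (Primrec.nat_mul.comp (neg.comp .fst) (neg.comp .snd)))
    (Primrec.nat_add.comp (Primrec.nat_mul.comp (pos.comp .fst) (neg.comp .snd))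
      (Primrec.nat_mul.comp (neg.comp .fst) (pos.comp .snd)))) fun ⟨a, b⟩ => ?_
  rw [Int.subNatNat_eq_coe]
  conv_rhs => rw [← Int.toNat_sub_toNat_neg a, ← Int.toNat_sub_toNat_neg b]
  push_cast
  ring

theorem primrec_natAbs : Primrec Int.natAbs :=
  (Primrec.nat_add.comp primrec_toNat primrec_toNat_neg).of_eq fun z => by omega

theorem primrec_entry (i j : Fin 2) : Primrec fun A : Mat => A i j :=
  have h : Primrec fun A : Fin 2 → Fin 2 → ℤ => A i j :=
    Primrec.fin_app.comp (Primrec.fin_app.comp .id (.const i)) (.const j)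
  h

theorem primrec_mat {f : α → Mat} (h : ∀ i j, Primrec fun a => f a i j) : Primrec f :=
  have h' : Primrec fun a => (f a : Fin 2 → Fin 2 → ℤ) :=
    Primrec.fin_curry.mpr (Primrec₂.swap (Primrec.fin_curry₁.mpr fun i =>
      Primrec.fin_curry.mpr (Primrec₂.swap (Primrec.fin_curry₁.mpr fun j => h i j))))
  h'

theorem primrec_mat_mul : Primrec₂ ((· * ·) : Mat → Mat → Mat) := by
  refine primrec_mat fun i j => ?_
  simp only [Matrix.mul_apply, Fin.sum_univ_two]
  have h (k : Fin 2) : Primrec fun p : Mat × Mat => p.1 i k * p.2 k j :=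
    primrec_int_mul.comp ((primrec_entry i k).comp .fst) ((primrec_entry k j).comp .snd)
  exact primrec_int_add.comp (h 0) (h 1)

theorem primrec_det : Primrec fun A : Mat => A.det := by
  simp only [Matrix.det_fin_two]
  exact primrec_int_sub.comp
    (primrec_int_mul.comp (primrec_entry 0 0) (primrec_entry 1 1))
    (primrec_int_mul.comp (primrec_entry 0 1) (primrec_entry 1 0))

theorem primrecPred_cong {N : γ → ℕ} {A B : γ → Mat} (hN : Primrec N) (hA : Primrec A)
    (hB : Primrec B) : PrimrecPred fun c => Cong (N c) (A c) (B c) := by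
  have h (i j : Fin 2) : PrimrecPred fun c => (A c i j - B c i j).natAbs % N c = 0 :=
    Primrec.eq.comp (Primrec.nat_mod.comp (primrec_natAbs.comp (primrec_int_sub.comp
      ((primrec_entry i j).comp hA) ((primrec_entry i j).comp hB))) hN) (.const 0)
  refine (((h 0 0).and (h 0 1)).and ((h 1 0).and (h 1 1))).of_eq fun c => ?_
  simp only [Cong, Fin.forall_fin_two, ← Nat.dvd_iff_mod_eq_zero, Int.natCast_dvd]

theorem primrecPred_forall_mem {L : γ → List α} (hL : Primrec L) {p : γ → α → Prop}
    (hp : PrimrecPred fun x : γ × α => p x.1 x.2) : PrimrecPred fun c => ∀ a ∈ L c, p c a :=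
  PrimrecRel.comp (PrimrecRel.forall_mem_list (R := fun a c => p c a)
    (hp.comp (Primrec.pair .snd .fst))) hL .id

theorem primrecPred_exists_mem {L : γ → List α} (hL : Primrec L) {p : γ → α → Prop}
    (hp : PrimrecPred fun x : γ × α => p x.1 x.2) : PrimrecPred fun c => ∃ a ∈ L c, p c a :=
  PrimrecRel.comp (PrimrecRel.exists_mem_list (R := fun a c => p c a)
    (hp.comp (Primrec.pair .snd .fst))) hL .id

theorem primrecPred_mem {L : γ → List α} {f : γ → α} (hL : Primrec L) (hf : Primrec f) :
    PrimrecPred fun c => f c ∈ L c :=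
  (primrecPred_exists_mem hL (p := fun c a => a = f c)
    (Primrec.eq.comp .snd (hf.comp .fst))).of_eq fun c => by simp

theorem primrecPred_imp {p q : γ → Prop} (hp : PrimrecPred p) (hq : PrimrecPred q) :
    PrimrecPred fun c => p c → q c :=
  (hp.not.or hq).of_eq fun _ => imp_iff_not_or.symm

theorem primrec_ball : Primrec ball :=
  Primrec.nat_iterate .id (.const [1]) (Primrec.to₂ (Primrec.list_append.comp .snd
    (Primrec.list_flatMap .snd (Primrec.to₂ (Primrec.list_map (.const sanovLetters)
      (Primrec.to₂ (primrec_mat_mul.comp (Primrec.snd.comp .fst) .snd)))))))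

theorem primrec_reach [DecidableEq α] {G : γ → List (α × Mat × α)} {k : γ → ℕ} (hG : Primrec G)
    (s : α) (hk : Primrec k) : Primrec fun c => reach (G c) s (k c) := by
  unfold reach
  have hfilter : Primrec₂ fun (L : List (α × Mat × α)) (p : α) => L.filter fun e => e.1 = p :=
    PrimrecRel.listFilter (R := fun (e : α × Mat × α) p => e.1 = p)
      (Primrec.eq.comp (Primrec.fst.comp .fst) .snd)
  have hmap : Primrec₂ fun (c : γ × List (α × Mat)) (y : α × Mat) =>
      ((G c.1).filter fun e => y.1 = e.1).map fun e => (e.2.2, y.2 * e.2.1) := by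
    refine Primrec.list_map
      (g := fun (x : (γ × List (α × Mat)) × α × Mat) (e : α × Mat × α) =>
        (e.2.2, x.2.2 * e.2.1)) ?_ ?_
    · refine (hfilter.comp (hG.comp (Primrec.fst.comp .fst)) (Primrec.fst.comp .snd)).of_eq ?_
      rintro ⟨c, y⟩
      simp only [eq_comm]
    · exact Primrec.to₂ (Primrec.pair (Primrec.snd.comp (Primrec.snd.comp .snd))
        (primrec_mat_mul.comp (Primrec.snd.comp (Primrec.snd.comp .fst))
          (Primrec.fst.comp (Primrec.snd.comp .snd))))
  exact Primrec.nat_iterate hk (.const _) (Primrec.to₂ (Primrec.list_flatMap .snd hmap))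

theorem primrecPred_isCertificate {G : γ → List (α × Mat × α)} {s t : γ → α} {T : γ → Mat}
    {m N : γ → ℕ} {nodes : γ → List (α × Mat)} {E : γ → List ((α × Mat) × Mat × (α × Mat))}
    (hG : Primrec G) (hs : Primrec s) (ht : Primrec t) (hT : Primrec T) (hm : Primrec m)
    (hN : Primrec N) (hnodes : Primrec nodes) (hE : Primrec E) :
    PrimrecPred fun c => IsCertificate (G c) (s c) (t c) (T c) (m c) (N c) (nodes c) (E c) := by
  have hball : Primrec fun c => ball (m c) := primrec_ball.comp hm
  have h₁ : PrimrecPred fun c => (s c, (1 : Mat)) ∈ nodes c :=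
    primrecPred_mem hnodes (hs.pair (.const 1))
  have h₂ : PrimrecPred fun c => ∀ x ∈ E c, x.2.1 ∈ ball (m c) :=
    primrecPred_forall_mem hE (primrecPred_mem (hball.comp .fst)
      (Primrec.fst.comp (Primrec.snd.comp .snd)))
  have h₃ : PrimrecPred fun c => ∀ x ∈ E c, ∀ y ∈ E c, x.2.2 = y.1 →
      x.2.1 * y.2.1 ∈ ball (m c) → (x.1, x.2.1 * y.2.1, y.2.2) ∈ E c := by
    refine primrecPred_forall_mem hE (primrecPred_forall_mem (hE.comp .fst) ?_)
    have hc : Primrec fun z : (γ × (α × Mat) × Mat × (α × Mat)) × (α × Mat) × Mat × (α × Mat) =>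
        z.1.1 := Primrec.fst.comp .fst
    have hx : Primrec fun z : (γ × (α × Mat) × Mat × (α × Mat)) × (α × Mat) × Mat × (α × Mat) =>
        z.1.2 := Primrec.snd.comp .fst
    have hmul := primrec_mat_mul.comp (Primrec.fst.comp (Primrec.snd.comp hx))
      (Primrec.fst.comp (Primrec.snd.comp .snd))
    exact primrecPred_imp
      (Primrec.eq.comp (Primrec.snd.comp (Primrec.snd.comp hx)) (Primrec.fst.comp .snd))
      (primrecPred_imp (primrecPred_mem (hball.comp hc) hmul)
        (primrecPred_mem (hE.comp hc) ((Primrec.fst.comp hx).pair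
          (hmul.pair (Primrec.snd.comp (Primrec.snd.comp .snd))))))
  have h₄ : PrimrecPred fun c => ∀ y ∈ nodes c, ∀ e ∈ G c, e.1 = y.1 → ∃ x ∈ E c,
      x.1 = y ∧ x.2.2 ∈ nodes c ∧ x.2.2.1 = e.2.2 ∧ y.2 * e.2.1 = x.2.1 * x.2.2.2 ∧
        Cong (N c) (y.2 * e.2.1) x.2.2.2 := by
    refine primrecPred_forall_mem hnodes (primrecPred_forall_mem (hG.comp .fst)
      (primrecPred_imp (Primrec.eq.comp (Primrec.fst.comp .snd)
        (Primrec.fst.comp (Primrec.snd.comp .fst)))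
        (primrecPred_exists_mem (hE.comp (Primrec.fst.comp .fst)) ?_)))
    have hc : Primrec fun z : ((γ × α × Mat) × α × Mat × α) × (α × Mat) × Mat × (α × Mat) =>
        z.1.1.1 := Primrec.fst.comp (Primrec.fst.comp .fst)
    have hy : Primrec fun z : ((γ × α × Mat) × α × Mat × α) × (α × Mat) × Mat × (α × Mat) =>
        z.1.1.2 := Primrec.snd.comp (Primrec.fst.comp .fst)
    have he : Primrec fun z : ((γ × α × Mat) × α × Mat × α) × (α × Mat) × Mat × (α × Mat) =>
        z.1.2 := Primrec.snd.comp .fst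
    have hx : Primrec fun z : ((γ × α × Mat) × α × Mat × α) × (α × Mat) × Mat × (α × Mat) =>
        z.2 := .snd
    have hz := Primrec.snd.comp (Primrec.snd.comp hx)
    have hmul := primrec_mat_mul.comp (Primrec.snd.comp hy) (Primrec.fst.comp (Primrec.snd.comp he))
    exact (Primrec.eq.comp (Primrec.fst.comp hx) hy).and
      ((primrecPred_mem (hnodes.comp hc) hz).and
        ((Primrec.eq.comp (Primrec.fst.comp hz) (Primrec.snd.comp (Primrec.snd.comp he))).and
          ((Primrec.eq.comp hmul (primrec_mat_mul.comp (Primrec.fst.comp (Primrec.snd.comp hx))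
            (Primrec.snd.comp hz))).and
            (primrecPred_cong (hN.comp hc) hmul (Primrec.snd.comp hz)))))
  have h₅ : PrimrecPred fun c => ∀ y ∈ nodes c, y.1 = t c → Cong (N c) y.2 (T c) →
      ∃ g ∈ ball (m c), g * y.2 = T c :=
    primrecPred_forall_mem hnodes
      (primrecPred_imp (Primrec.eq.comp (Primrec.fst.comp .snd) (ht.comp .fst))
        (primrecPred_imp
          (primrecPred_cong (hN.comp .fst) (Primrec.snd.comp .snd) (hT.comp .fst))
          (primrecPred_exists_mem (hball.comp .fst)
            (Primrec.eq.comp (primrec_mat_mul.comp .snd (Primrec.snd.comp (Primrec.snd.comp .fst)))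
              (hT.comp (Primrec.fst.comp .fst))))))
  have h₆ : PrimrecPred fun c => ∀ x ∈ E c, x.1 = (s c, 1) → x.2.2.1 = t c →
      x.2.1 * x.2.2.2 ≠ T c := by
    refine primrecPred_forall_mem hE ?_
    have hg : Primrec fun z : γ × (α × Mat) × Mat × (α × Mat) => z.2.2.1 :=
      Primrec.fst.comp (Primrec.snd.comp .snd)
    have hz : Primrec fun z : γ × (α × Mat) × Mat × (α × Mat) => z.2.2.2 :=
      Primrec.snd.comp (Primrec.snd.comp .snd)
    exact primrecPred_imp
      (Primrec.eq.comp (Primrec.fst.comp .snd) ((hs.comp .fst).pair (.const 1)))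
      (primrecPred_imp (Primrec.eq.comp (Primrec.fst.comp hz) (ht.comp .fst))
        (Primrec.eq.comp (primrec_mat_mul.comp hg (Primrec.snd.comp hz)) (hT.comp .fst)).not)
  refine (h₁.and (h₂.and (h₃.and (h₄.and (h₅.and h₆))))).of_eq fun c => ?_
  exact ⟨fun ⟨a₁, a₂, a₃, a₄, a₅, a₆⟩ => ⟨a₁, a₂, a₃, a₄, a₅, a₆⟩,
    fun ⟨a₁, a₂, a₃, a₄, a₅, a₆⟩ => ⟨a₁, a₂, a₃, a₄, a₅, a₆⟩⟩

/-- The projection of a primitive recursive relation is recursively enumerable. -/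
theorem rePred_exists {p : α → β → Prop} (hp : PrimrecPred fun x : α × β => p x.1 x.2) :
    REPred fun a => ∃ b, p a b := by
  classical
  have hdec : Primrec fun x : α × ℕ =>
      (Encodable.decode (α := β) x.2).elim false fun b => decide (p x.1 b) := by
    have h := Primrec.option_casesOn (o := fun x : α × ℕ => Encodable.decode (α := β) x.2)
      (f := fun _ => false) (g := fun x b => decide (p x.1 b))
      (Primrec.decode.comp .snd) (.const false)
      (Primrec.to₂ ((primrecPred_iff_primrec_decide.mp hp).comp
        (Primrec.pair (Primrec.fst.comp .fst) .snd)))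
    refine h.of_eq fun x => ?_
    cases Encodable.decode (α := β) x.2 <;> rfl
  have hfind := Partrec.rfind (p := fun a => (fun n =>
    ((Encodable.decode (α := β) n).elim false fun b => decide (p a b) : Bool) : ℕ →. Bool))
    hdec.to_comp.partrec
  refine hfind.dom_re.of_eq fun a => ?_
  refine Nat.rfind_dom.trans ?_
  constructor
  · rintro ⟨n, hn, -⟩
    have hn' := Part.mem_some_iff.mp hn
    cases h : Encodable.decode (α := β) n with
    | none => simp [h] at hn'
    | some b => exact ⟨b, by simpa [h] using hn'⟩
  · rintro ⟨b, hb⟩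
    exact ⟨Encodable.encode b, Part.mem_some_iff.mpr (by simp [hb]), fun _ => trivial⟩

end Primitive

/-! ### The graph of an equation -/

section InputGraph

/-- The matrix of a label of an automaton, where the empty label is sent to `1`. -/
def labelMat : Option Letter → Mat
  | none => 1
  | some a => (a.toGL : Mat)

/-- The part of the graph that belongs to the `i`-th automaton and the `i`-th matrix: it leads from
the position `(2 * i, 0)` through the states `q` of the automaton, at the positions
`(2 * i + 1, q)`, to the position `(2 * i + 2, 0)`. The two filters keep numbers that are not states
of the automaton out of reach. -/
def itemEdges (i : ℕ) (x : Automaton × Mat) : List ((ℕ × ℕ) × Mat × (ℕ × ℕ)) :=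
  ((x.1.initial.filter fun q => q < x.1.numStates).map fun q =>
      ((2 * i, 0), 1, (2 * i + 1, q))) ++
    ((x.1.transitions.filter fun e => e.2.2 < x.1.numStates).map fun e =>
      ((2 * i + 1, e.1), labelMat e.2.1, (2 * i + 1, e.2.2))) ++
    x.1.accepting.map fun q => ((2 * i + 1, q), x.2, (2 * i + 2, 0))

/-- The graph of the list of pairs `(𝒜₁, M₁), …, (𝒜ₜ, Mₜ)`: the products along its paths from
`(0, 0)` to `(2 * t, 0)` are the matrices `A₁ M₁ ⋯ Aₜ Mₜ`. -/
def edges (l : List (Automaton × Mat)) : List ((ℕ × ℕ) × Mat × (ℕ × ℕ)) :=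
  (List.range l.length).flatMap fun i => (l[i]?).toList.flatMap fun x => itemEdges i x

/-- The square of the last matrix: the equation `A₁ M₁ ⋯ Aₜ = Mₜ` with both sides multiplied by
`Mₜ`. -/
def target (l : List (Automaton × Mat)) : Mat :=
  (l[l.length - 1]?).elim 1 fun x => x.2 * x.2

theorem mem_edges {l : List (Automaton × Mat)} {e : (ℕ × ℕ) × Mat × (ℕ × ℕ)} :
    e ∈ edges l ↔ ∃ i x, l[i]? = some x ∧ e ∈ itemEdges i x := by
  simp only [edges, List.mem_flatMap, List.mem_range, Option.mem_toList]
  constructor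
  · rintro ⟨i, -, x, hx, he⟩
    exact ⟨i, x, hx, he⟩
  · rintro ⟨i, x, hx, he⟩
    exact ⟨i, (List.getElem?_eq_some_iff.mp hx).1, x, hx, he⟩

theorem mem_itemEdges {i : ℕ} {x : Automaton × Mat} {p r : ℕ × ℕ} {v : Mat} :
    (p, v, r) ∈ itemEdges i x ↔
      (∃ q ∈ x.1.initial, q < x.1.numStates ∧ p = (2 * i, 0) ∧ v = 1 ∧ r = (2 * i + 1, q)) ∨
      (∃ q a q', (q, a, q') ∈ x.1.transitions ∧ q' < x.1.numStates ∧ p = (2 * i + 1, q) ∧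
        v = labelMat a ∧ r = (2 * i + 1, q')) ∨
      (∃ q ∈ x.1.accepting, p = (2 * i + 1, q) ∧ v = x.2 ∧ r = (2 * i + 2, 0)) := by
  simp only [itemEdges, List.mem_append, List.mem_map, List.mem_filter, decide_eq_true_eq,
    Prod.mk.injEq, Prod.exists, or_assoc]
  grind

/-- The products `A₁ M₁ ⋯ Aₖ Mₖ` with `Aᵢ` in the subset given by `𝒜ᵢ`. -/
inductive PrefixProduct (l : List (Automaton × Mat)) : ℕ → Mat → Prop
  | zero : PrefixProduct l 0 1
  | succ {i V x A} : PrefixProduct l i V → l[i]? = some x → A ∈ x.1.subset →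
      PrefixProduct l (i + 1) (V * ((A : Matrix.GeneralLinearGroup (Fin 2) ℤ) : Mat) * x.2)

theorem labelMat_mul_phi (a : Option Letter) (w : List (Option Letter)) :
    labelMat a * (phi w.reduceOption : Mat) = (phi (a :: w).reduceOption : Mat) := by
  cases a with
  | none => simp [labelMat]
  | some a => simp [labelMat, phi]

theorem run_of_isPath {l : List (Automaton × Mat)} {i : ℕ} {x : Automaton × Mat}
    (hx : l[i]? = some x) {s q : Fin x.1.numStates} {w : List (Option Letter)}
    (h : x.1.toεNFA.IsPath s q w) :
    Run (edges l) (2 * i + 1, (s : ℕ)) (phi w.reduceOption : Mat) (2 * i + 1, (q : ℕ)) := by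
  induction h with
  | nil s => simpa [phi] using Run.nil
  | cons t s u a w hst _ ih =>
    rw [← labelMat_mul_phi]
    exact (Run.single (mem_edges.mpr ⟨i, x, hx, mem_itemEdges.mpr
      (Or.inr (Or.inl ⟨s, a, t, hst, t.2, rfl, rfl, rfl⟩))⟩)).trans ih

theorem PrefixProduct.run {l : List (Automaton × Mat)} {k : ℕ} {V : Mat}
    (h : PrefixProduct l k V) : Run (edges l) (0, 0) V (2 * k, 0) := by
  induction h with
  | zero => exact .nil
  | @succ i V x A _ hx hA ih =>
    obtain ⟨w, hw, rfl⟩ := hA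
    obtain ⟨s, q, w', hs, hq, rfl, hpath⟩ := (εNFA.mem_accepts_iff_exists_path _).mp hw
    have h₁ := ih.snoc (mem_edges.mpr ⟨i, x, hx, mem_itemEdges.mpr
      (Or.inl ⟨s, hs, s.2, rfl, rfl, rfl⟩)⟩)
    rw [mul_one] at h₁
    exact (h₁.trans (run_of_isPath hx hpath)).snoc (mem_edges.mpr ⟨i, x, hx, mem_itemEdges.mpr
      (Or.inr (Or.inr ⟨q, hq, rfl, rfl, rfl⟩))⟩)

/-- The positions and products that are reached by runs from `(0, 0)`: between two automata the
product is a prefix product, inside an automaton there is an additional factor that is read along a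
path of the automaton. -/
theorem run_edges_cases {l : List (Automaton × Mat)} {V : Mat} {p : ℕ × ℕ}
    (h : Run (edges l) (0, 0) V p) :
    (∃ i, p = (2 * i, 0) ∧ PrefixProduct l i V) ∨
      ∃ i x U, ∃ s q : Fin (Prod.fst x : Automaton).numStates, ∃ w, p = (2 * i + 1, (q : ℕ)) ∧
        l[i]? = some x ∧ PrefixProduct l i U ∧ s ∈ x.1.toεNFA.start ∧ x.1.toεNFA.IsPath s q w ∧
        V = U * (phi w.reduceOption : Mat) := by
  induction h with
  | nil => exact Or.inl ⟨0, rfl, .zero⟩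
  | @snoc V p v r _ he ih =>
    obtain ⟨j, y, hy, he⟩ := mem_edges.mp he
    rcases mem_itemEdges.mp he with
      ⟨q', hq', hlt, rfl, rfl, rfl⟩ | ⟨q₁, a, q', ht, hlt, rfl, rfl, rfl⟩ | ⟨q', hq', rfl, rfl, rfl⟩
    · rcases ih with ⟨i, hp, hV⟩ | ⟨i, x, U, s, q, w, hp, -⟩
      · obtain rfl : j = i := by simpa using hp
        exact Or.inr ⟨j, y, V, ⟨q', hlt⟩, ⟨q', hlt⟩, [], rfl, hy, hV, hq', .nil _, by simp [phi]⟩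
      · have := congrArg Prod.fst hp
        dsimp only at this
        omega
    · rcases ih with ⟨i, hp, hV⟩ | ⟨i, x, U, s, q, w, hp, hx, hU, hs, hpath, rfl⟩
      · have := congrArg Prod.fst hp
        dsimp only at this
        omega
      · obtain ⟨hij, rfl⟩ : j = i ∧ q₁ = q := by simpa using hp
        subst hij
        obtain rfl : x = y := by simpa [hx] using hy
        refine Or.inr ⟨j, x, U, s, ⟨q', hlt⟩, w ++ [a], rfl, hx, hU, hs, ?_, ?_⟩
        · exact (εNFA.isPath_append _).mpr ⟨q, hpath, (εNFA.isPath_singleton _).mpr ht⟩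
        · cases a <;> simp [labelMat, phi, List.reduceOption_append, mul_assoc]
    · rcases ih with ⟨i, hp, hV⟩ | ⟨i, x, U, s, q, w, hp, hx, hU, hs, hpath, rfl⟩
      · have := congrArg Prod.fst hp
        dsimp only at this
        omega
      · obtain ⟨hij, rfl⟩ : j = i ∧ q' = q := by simpa using hp
        subst hij
        obtain rfl : x = y := by simpa [hx] using hy
        refine Or.inl ⟨j + 1, rfl, hU.succ hx ⟨w.reduceOption, ?_, rfl⟩⟩
        exact (εNFA.mem_accepts_iff_exists_path _).mpr ⟨s, q, w, hs, hq', rfl, hpath⟩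

theorem run_edges_iff {l : List (Automaton × Mat)} {k : ℕ} {V : Mat} :
    Run (edges l) (0, 0) V (2 * k, 0) ↔ PrefixProduct l k V := by
  refine ⟨fun h => ?_, fun h => h.run⟩
  rcases run_edges_cases h with ⟨i, hp, hV⟩ | ⟨i, x, U, s, q, w, hp, -⟩
  · obtain rfl : k = i := by simpa using hp
    exact hV
  · have := congrArg Prod.fst hp
    dsimp only at this
    omega

theorem isUnit_det_GL (A : Matrix.GeneralLinearGroup (Fin 2) ℤ) : IsUnit (A : Mat).det :=
  (Matrix.isUnit_iff_isUnit_det _).mp A.isUnit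

/-- Only the matrices `Mᵢ` contribute to the determinant, up to sign. -/
theorem PrefixProduct.det_dvd_take {l : List (Automaton × Mat)} {k : ℕ} {V : Mat}
    (h : PrefixProduct l k V) : V.det ∣ ((l.take k).map fun x => x.2.det).prod := by
  induction h with
  | zero => simp
  | @succ i V x A _ hx _ ih =>
    rw [Matrix.det_mul, Matrix.det_mul, List.take_add_one, hx]
    simp only [Option.toList_some, List.map_append, List.prod_append, List.map_cons, List.map_nil,
      List.prod_singleton]
    exact mul_dvd_mul ((isUnit_det_GL A).mul_right_dvd.mpr ih) dvd_rfl

theorem det_dvd_of_run {l : List (Automaton × Mat)} {V : Mat} {p : ℕ × ℕ}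
    (h : Run (edges l) (0, 0) V p) : V.det ∣ (l.map fun x => x.2.det).prod := by
  have key {k : ℕ} {U : Mat} (hU : PrefixProduct l k U) :
      U.det ∣ (l.map fun x => x.2.det).prod := by
    refine hU.det_dvd_take.trans ?_
    rw [← List.prod_take_mul_prod_drop (l.map fun x => x.2.det) k, List.map_take]
    exact dvd_mul_right _ _
  rcases run_edges_cases h with ⟨i, -, hV⟩ | ⟨i, x, U, s, q, w, -, -, hU, -, -, rfl⟩
  · exact key hV
  · rw [Matrix.det_mul]
    exact (isUnit_det_GL _).mul_right_dvd.mpr (key hU)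

theorem take_ofFn_congr {α : Type*} {n k : ℕ} {f g : Fin n → α}
    (h : ∀ i : Fin n, (i : ℕ) < k → f i = g i) :
    (List.ofFn f).take k = (List.ofFn g).take k := by
  refine List.ext_getElem (by simp) fun i h₁ h₂ => ?_
  simp only [List.length_take, lt_min_iff] at h₁
  simpa using h _ h₁.1

theorem prefixProduct_ofFn_iff {n : ℕ} (𝒜 : Fin n → Automaton) (M : Fin n → Mat) (V : Mat) :
    PrefixProduct (List.ofFn fun i => (𝒜 i, M i)) n V ↔
      ∃ A : Fin n → Matrix.GeneralLinearGroup (Fin 2) ℤ, (∀ i, A i ∈ (𝒜 i).subset) ∧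
        V = (List.ofFn fun i => (A i : Mat) * M i).prod := by
  constructor
  · have key {k : ℕ} {V : Mat} (h : PrefixProduct (List.ofFn fun i => (𝒜 i, M i)) k V) :
        ∃ A : Fin n → Matrix.GeneralLinearGroup (Fin 2) ℤ,
          (∀ i : Fin n, (i : ℕ) < k → A i ∈ (𝒜 i).subset) ∧
          V = ((List.ofFn fun i => (A i : Mat) * M i).take k).prod := by
      induction h with
      | zero => exact ⟨1, by simp, by simp⟩
      | @succ k V x a _ hx ha ih =>
        obtain ⟨A, hA, rfl⟩ := ih
        obtain ⟨hk, rfl⟩ := List.getElem?_eq_some_iff.mp hx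
        have hk' : k < n := by simpa using hk
        simp only [List.getElem_ofFn] at ha ⊢
        refine ⟨Function.update A ⟨k, hk'⟩ a, fun i hi => ?_, ?_⟩
        · rcases eq_or_ne i ⟨k, hk'⟩ with rfl | hne
          · simpa using ha
          · rw [Function.update_of_ne hne]
            exact hA i (lt_of_le_of_ne (Nat.le_of_lt_succ hi) fun h => hne (Fin.ext h))
        · rw [List.prod_take_succ _ _ (by simpa using hk'), mul_assoc]
          congr 1
          · refine congrArg List.prod (take_ofFn_congr fun i hi => ?_)
            rw [Function.update_of_ne fun h => hi.ne (congrArg Fin.val h)]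
          · simp
    intro h
    obtain ⟨A, hA, rfl⟩ := key h
    exact ⟨A, fun i => hA i i.2, by rw [List.take_of_length_le (by simp)]⟩
  · rintro ⟨A, hA, rfl⟩
    have key (k : ℕ) (hk : k ≤ n) : PrefixProduct (List.ofFn fun i => (𝒜 i, M i)) k
        ((List.ofFn fun i => (A i : Mat) * M i).take k).prod := by
      induction k with
      | zero => simpa using PrefixProduct.zero
      | succ k ih =>
        rw [List.prod_take_succ _ _ (by simpa using hk)]
        have hk' : k < n := hk
        have := (ih hk'.le).succ (x := (𝒜 ⟨k, hk'⟩, M ⟨k, hk'⟩)) (by simp [hk']) (hA ⟨k, hk'⟩)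
        simpa [mul_assoc] using this
    have := key n le_rfl
    rwa [List.take_of_length_le (by simp)] at this

/-- The condition on the input: there is at least one matrix, and all matrices are nonsingular. -/
def Admissible (l : List (Automaton × Mat)) : Prop :=
  l.length ≠ 0 ∧ ∀ x ∈ l, x.2.det ≠ 0

/-- At least one matrix is needed for the start and the end of the graph to be different, which
excludes the empty path: it is not represented by an edge of a certificate. -/
theorem not_run_iff_exists_isCertificate {l : List (Automaton × Mat)} (hl : Admissible l) :
    ¬ Run (edges l) (0, 0) (target l) (2 * l.length, 0) ↔
      ∃ m N nodes E, IsCertificate (edges l) (0, 0) (2 * l.length, 0) (target l) m N nodes E := by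
  obtain ⟨hlen, hdet⟩ := hl
  have hlt : l.length - 1 < l.length := by omega
  have htarget : target l = l[l.length - 1].2 * l[l.length - 1].2 := by
    simp [target, List.getElem?_eq_getElem hlt]
  constructor
  · intro hrun
    have hprod : (l.map fun x => x.2.det).prod ≠ 0 := by
      simpa [List.prod_eq_zero_iff] using hdet
    -- The square makes room for the determinant of the target, which is a square itself.
    refine exists_isCertificate (D := ((l.map fun x => x.2.det).prod ^ 2).natAbs)
      (by simpa using hprod)
      (fun p V hV => Int.dvd_natAbs.mpr ((det_dvd_of_run hV).trans (dvd_pow_self _ two_ne_zero)))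
      (Int.dvd_natAbs.mpr ?_) hrun
    rw [htarget, Matrix.det_mul, ← sq]
    exact pow_dvd_pow_of_dvd
      (List.dvd_prod (List.mem_map.mpr ⟨_, List.getElem_mem hlt, rfl⟩)) 2
  · rintro ⟨m, N, nodes, E, h⟩
    refine h.not_run (by simpa [eq_comm] using hlen) ?_
    rw [htarget, Matrix.det_mul]
    have := hdet _ (List.getElem_mem hlt)
    exact mul_ne_zero this this

end InputGraph

/-! ### Decidability -/

section Decidability

variable {γ : Type*} [Primcodable γ]

theorem primrec_numStates : Primrec Automaton.numStates :=
  Primrec.fst.comp (Primrec.of_equiv (e := Automaton.equivProd))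

theorem primrec_transitions : Primrec Automaton.transitions :=
  (Primrec.fst.comp .snd).comp (Primrec.of_equiv (e := Automaton.equivProd))

theorem primrec_initial : Primrec Automaton.initial :=
  (Primrec.fst.comp (Primrec.snd.comp .snd)).comp (Primrec.of_equiv (e := Automaton.equivProd))

theorem primrec_accepting : Primrec Automaton.accepting :=
  (Primrec.snd.comp (Primrec.snd.comp .snd)).comp (Primrec.of_equiv (e := Automaton.equivProd))

theorem primrec_itemEdges : Primrec₂ itemEdges := by
  have ha : Primrec fun z : ℕ × Automaton × Mat => z.2.1 := Primrec.fst.comp .snd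
  have heven : Primrec fun z : ℕ × Automaton × Mat => 2 * z.1 := Primrec.nat_double.comp .fst
  have hodd : Primrec fun z : ℕ × Automaton × Mat => 2 * z.1 + 1 :=
    Primrec.nat_double_succ.comp .fst
  have hfilter₁ : Primrec₂ fun (L : List ℕ) (n : ℕ) => L.filter fun q => q < n :=
    PrimrecRel.listFilter Primrec.nat_lt
  have hfilter₂ : Primrec₂ fun (L : List (ℕ × Option Letter × ℕ)) (n : ℕ) =>
      L.filter fun e => e.2.2 < n :=
    PrimrecRel.listFilter (R := fun (e : ℕ × Option Letter × ℕ) n => e.2.2 < n)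
      (Primrec.nat_lt.comp (Primrec.snd.comp (Primrec.snd.comp .fst)) .snd)
  have hg₁ : Primrec₂ fun (z : ℕ × Automaton × Mat) (q : ℕ) =>
      (((2 * z.1, 0), (1 : Mat), (2 * z.1 + 1, q)) : (ℕ × ℕ) × Mat × (ℕ × ℕ)) :=
    ((heven.comp .fst).pair (.const 0)).pair ((Primrec.const 1).pair ((hodd.comp .fst).pair .snd))
  have hg₂ : Primrec₂ fun (z : ℕ × Automaton × Mat) (e : ℕ × Option Letter × ℕ) =>
      (((2 * z.1 + 1, e.1), labelMat e.2.1, (2 * z.1 + 1, e.2.2)) : (ℕ × ℕ) × Mat × (ℕ × ℕ)) :=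
    ((hodd.comp .fst).pair (Primrec.fst.comp .snd)).pair
      (((Primrec.dom_finite labelMat).comp (Primrec.fst.comp (Primrec.snd.comp .snd))).pair
        ((hodd.comp .fst).pair (Primrec.snd.comp (Primrec.snd.comp .snd))))
  have hg₃ : Primrec₂ fun (z : ℕ × Automaton × Mat) (q : ℕ) =>
      (((2 * z.1 + 1, q), z.2.2, (2 * z.1 + 2, 0)) : (ℕ × ℕ) × Mat × (ℕ × ℕ)) :=
    ((hodd.comp .fst).pair .snd).pair ((Primrec.snd.comp (Primrec.snd.comp .fst)).pair
      ((Primrec.succ.comp (hodd.comp .fst)).pair (.const 0)))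
  have h₁ := Primrec.list_map
    (hfilter₁.comp (primrec_initial.comp ha) (primrec_numStates.comp ha)) hg₁
  have h₂ := Primrec.list_map
    (hfilter₂.comp (primrec_transitions.comp ha) (primrec_numStates.comp ha)) hg₂
  have h₃ := Primrec.list_map (primrec_accepting.comp ha) hg₃
  exact Primrec.list_append.comp (Primrec.list_append.comp h₁ h₂) h₃

theorem primrec_edges : Primrec edges :=
  Primrec.list_flatMap (Primrec.list_range.comp .list_length)
    (Primrec.to₂ (Primrec.list_flatMap
      (Primrec.optionToList.comp (Primrec.list_getElem?.comp .fst .snd))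
      (Primrec.to₂ (primrec_itemEdges.comp (Primrec.snd.comp .fst) .snd))))

theorem primrec_target : Primrec target := by
  have h : Primrec fun l : List (Automaton × Mat) => l[l.length - 1]? :=
    Primrec.list_getElem?.comp .id (Primrec.nat_sub.comp .list_length (.const 1))
  refine (Primrec.option_casesOn (g := fun _ x => x.2 * x.2) h (.const 1) (Primrec.to₂
    (primrec_mat_mul.comp (Primrec.snd.comp .snd) (Primrec.snd.comp .snd)))).of_eq fun l => ?_
  unfold target
  cases l[l.length - 1]? <;> rfl

theorem primrecPred_admissible : PrimrecPred Admissible :=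
  (Primrec.eq.comp .list_length (.const 0)).not.and
    (primrecPred_forall_mem .id
      (Primrec.eq.comp (primrec_det.comp (Primrec.snd.comp .snd)) (.const 0)).not)

/-- Both the solvability of the equation of an admissible list and its failure have finite
witnesses. -/
theorem computablePred_run : ComputablePred fun l : List (Automaton × Mat) =>
    Admissible l ∧ Run (edges l) (0, 0) (target l) (2 * l.length, 0) := by
  have hgoal : Primrec fun l : List (Automaton × Mat) => (2 * l.length, 0) :=
    (Primrec.nat_double.comp .list_length).pair (.const 0)
  refine ComputablePred.computable_iff_re_compl_re'.mpr ⟨?_, ?_⟩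
  · refine (rePred_exists (p := fun (l : List (Automaton × Mat)) (k : ℕ) => Admissible l ∧
      ((2 * l.length, 0), target l) ∈ reach (edges l) (0, 0) k) ?_).of_eq fun l => ?_
    · exact (primrecPred_admissible.comp .fst).and (primrecPred_mem
        (primrec_reach (primrec_edges.comp .fst) _ .snd)
        ((hgoal.comp .fst).pair (primrec_target.comp .fst)))
    · rw [exists_and_left, ← run_iff_exists_mem_reach]
  · refine (rePred_exists (p := fun (l : List (Automaton × Mat)) (c : ℕ × ℕ ×
      List ((ℕ × ℕ) × Mat) × List (((ℕ × ℕ) × Mat) × Mat × ((ℕ × ℕ) × Mat))) => ¬ Admissible l ∨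
        IsCertificate (edges l) (0, 0) (2 * l.length, 0) (target l) c.1 c.2.1 c.2.2.1 c.2.2.2)
        ?_).of_eq fun l => ?_
    · exact (primrecPred_admissible.comp .fst).not.or (primrecPred_isCertificate
        (primrec_edges.comp .fst) (.const _) (hgoal.comp .fst) (primrec_target.comp .fst)
        (Primrec.fst.comp .snd) (Primrec.fst.comp (Primrec.snd.comp .snd))
        (Primrec.fst.comp (Primrec.snd.comp (Primrec.snd.comp .snd)))
        (Primrec.snd.comp (Primrec.snd.comp (Primrec.snd.comp .snd))))
    · rw [exists_or, exists_const]
      by_cases hl : Admissible l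
      · simp only [hl, not_true_eq_false, false_or, true_and, not_run_iff_exists_isCertificate hl,
          Prod.exists]
      · simp [hl]

end Decidability

end GL2Z

/-- One algorithm takes `(𝒜₁, M₁), …, (𝒜ₜ, Mₜ)` as input, where the automaton `𝒜ᵢ` presents the
regular subset `𝒮ᵢ`, and decides, for all nonsingular `M₁, …, Mₜ`, whether the equation
`A₁ M₁ ⋯ Aₜ₋₁ Mₜ₋₁ Aₜ = Mₜ` has a solution with `Aᵢ ∈ 𝒮ᵢ`. Here `t = n + 1`. -/
theorem mainTheorem2 :
    ∃ f : List (GL2Z.Automaton × Matrix (Fin 2) (Fin 2) ℤ) → Bool, Computable f ∧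
      ∀ (n : ℕ) (𝒜 : Fin (n + 1) → GL2Z.Automaton)
        (M : Fin (n + 1) → Matrix (Fin 2) (Fin 2) ℤ),
        (∀ i, (M i).det ≠ 0) →
        (f (List.ofFn fun i => (𝒜 i, M i)) = true ↔
          ∃ A : Fin (n + 1) → Matrix.GeneralLinearGroup (Fin 2) ℤ,
            (∀ i, A i ∈ (𝒜 i).subset) ∧
            (List.ofFn fun i : Fin n =>
                (A i.castSucc : Matrix (Fin 2) (Fin 2) ℤ) * M i.castSucc).prod *
              (A (Fin.last n) : Matrix (Fin 2) (Fin 2) ℤ) = M (Fin.last n)) := by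
  obtain ⟨_, hf⟩ := GL2Z.computablePred_run
  refine ⟨_, hf, fun n 𝒜 M hM => ?_⟩
  have hadm : GL2Z.Admissible (List.ofFn fun i => (𝒜 i, M i)) := by
    refine ⟨by simp, fun x hx => ?_⟩
    obtain ⟨i, rfl⟩ := (List.mem_ofFn' _ _).mp hx
    exact hM i
  have htarget : GL2Z.target (List.ofFn fun i => (𝒜 i, M i)) = M (Fin.last n) * M (Fin.last n) := by
    simp only [GL2Z.target, List.length_ofFn, Nat.add_sub_cancel, List.getElem?_ofFn,
      Nat.lt_add_one, dite_true, Option.elim_some]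
    rfl
  rw [decide_eq_true_iff]
  change GL2Z.Admissible _ ∧ _ ↔ _
  rw [and_iff_right hadm, GL2Z.run_edges_iff, List.length_ofFn,
    GL2Z.prefixProduct_ofFn_iff, htarget]
  refine exists_congr fun A => and_congr_right fun _ => ?_
  rw [List.ofFn_succ', List.prod_concat, ← mul_assoc]
  exact ⟨fun h => (GL2Z.mul_right_cancel_of_det_ne_zero (hM _) h).symm, fun h => by rw [h]⟩
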